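/- Let $\Omega\subset\mathbb{C}$ be a nonempty bounded connected open set that is regular (i.e. $\Omega$ equals the interior of its closure) and whose closure has connected complement $\mathbb{C}\setminus\overline{\Omega}$. Then there exists an entire function $f$ such that $\Omega$ is an oscillating wandering domain of $f$ and every iterate $f^n$, $n\ge 0$, is univalent (injective and holomorphic) on $\Omega$. Here the Fatou set of $f$ is the set of points having an open neighbourhood on which the iterates $(f^n)$ form a normal family (every sequence of iterates has a subsequence that converges locally uniformly to a finite function or to $\infty$). A wandering domain of $f$ is a connected component $\Omega$ of the Fatou set with $f^n(\Omega)\cap f^m(\Omega)=\emptyset$ for all integers $n\neq m$, $n,m\ge 0$. It is oscillating if both $\infty$ and some finite point $a\in\mathbb{C}$ are limit functions, i.e. there are strictly increasing sequences $(n_k)$, $(m_k)$ of nonnegative integers such that $f^{n_k}\to\infty$ and $f^{m_k}\to a$ locally uniformly on $\Omega$ as $k\to\infty$. -/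

import Mathlib

open Filter Topology

/-- The sequence of functions `F k` tends to `∞` locally uniformly on `U`,
i.e. uniformly on every compact subset of `U`. -/
def TendstoInftyLocallyUniformlyOn (F : ℕ → ℂ → ℂ) (U : Set ℂ) : Prop :=
  ∀ K : Set ℂ, K ⊆ U → IsCompact K → ∀ R : ℝ, ∀ᶠ k in atTop, ∀ z ∈ K, R < ‖F k z‖

/-- A family of functions (in our use: holomorphic ones) is normal on `U` if every sequence of
members of the family has a subsequence which, locally uniformly on `U`, either converges to a
finite limit function or tends to `∞`. -/
def IsNormalFamilyOn {ι : Type*} (F : ι → ℂ → ℂ) (U : Set ℂ) : Prop :=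
  ∀ s : ℕ → ι, ∃ φ : ℕ → ℕ, StrictMono φ ∧
    ((∃ g : ℂ → ℂ, TendstoLocallyUniformlyOn (fun k => F (s (φ k))) g atTop U) ∨
      TendstoInftyLocallyUniformlyOn (fun k => F (s (φ k))) U)

/-- The Fatou set of `f`: the points having an open neighbourhood on which the iterates
of `f` form a normal family. -/
def fatouSet (f : ℂ → ℂ) : Set ℂ :=
  {p | ∃ U : Set ℂ, IsOpen U ∧ p ∈ U ∧ IsNormalFamilyOn (fun n : ℕ => f^[n]) U}

/-- `Ω` is a Fatou component of `f`: a connected component of the Fatou set. -/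
def IsFatouComponent (f : ℂ → ℂ) (Ω : Set ℂ) : Prop :=
  ∃ p ∈ fatouSet f, Ω = connectedComponentIn (fatouSet f) p

/-- `Ω` is pre-periodic: `f^n(Ω)` meets `f^m(Ω)` for some `n ≠ m`. -/
def IsPreperiodicSet (f : ℂ → ℂ) (Ω : Set ℂ) : Prop :=
  ∃ n m : ℕ, n ≠ m ∧ (f^[n] '' Ω ∩ f^[m] '' Ω).Nonempty

/-- A wandering domain is a Fatou component which is not pre-periodic. -/
def IsWanderingDomain (f : ℂ → ℂ) (Ω : Set ℂ) : Prop :=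
  IsFatouComponent f Ω ∧ ¬ IsPreperiodicSet f Ω

/-- `g` is a (finite) limit function of the iterates of `f` on `Ω`. -/
def IsLimitFunctionOn (f : ℂ → ℂ) (Ω : Set ℂ) (g : ℂ → ℂ) : Prop :=
  ∃ φ : ℕ → ℕ, StrictMono φ ∧ TendstoLocallyUniformlyOn (fun k => f^[φ k]) g atTop Ω

/-- `∞` is a limit function of the iterates of `f` on `Ω`. -/
def IsInftyLimitFunctionOn (f : ℂ → ℂ) (Ω : Set ℂ) : Prop :=
  ∃ φ : ℕ → ℕ, StrictMono φ ∧ TendstoInftyLocallyUniformlyOn (fun k => f^[φ k]) Ω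

/-- An oscillating wandering domain: both `∞` and some finite point are limit functions. -/
def IsOscillatingWanderingDomain (f : ℂ → ℂ) (Ω : Set ℂ) : Prop :=
  IsWanderingDomain f Ω ∧ IsInftyLimitFunctionOn f Ω ∧
    ∃ a : ℂ, IsLimitFunctionOn f Ω (fun _ => a)

/-! The function is a limit of entire functions, each obtained from the previous one by Runge
approximation. Let `K` be the closure of `Ω`. Choose compact neighbourhoods `T 0 ⊇ S 0 ⊇ T 1 ⊇ …` of
`K` and points `a k` in `T k` off `S k` that accumulate at every frontier point of `Ω`. Regularity
of `Ω` provides such points outside `K`; connectedness of the complement of `K` lets each `S k` have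
connected complement, as Runge's theorem requires. A point `z₀` stays fixed with multiplier 2
throughout, and `z₀ + 1` is the centre of an invariant disc.

At each stage the `n`-th iterate of the current `f` is almost an affine map `z ↦ α * z + β` on `T
k`, with image far outside the disc about `z₀` on which `f` has to be kept. The next map
(`Stage.exists_next`) stays close to `f` on that disc. On the image of `T (k + 1)` it is close to
the inverse of the `n`-th iterate followed by `z ↦ σ * z + b`, which gives a tiny copy next to `z₀`;
the image of `a k` goes near `z₀ + 1`. The point `b` is chosen so that its orbit leaves the disc at
a point `c` without meeting a critical point. The tiny copy follows this orbit almost affinely, and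
a translation near `c` throws it far away, which restores the induction hypothesis. Every map close
enough to a stage satisfies its estimates, hence so does the limit `F`.

The iterates shrink `Ω`, so `Ω` lies in the Fatou set. Every neighbourhood of a frontier point
contains points escaping along the times `n` and some `a k` with bounded orbit, so the frontier
misses the Fatou set and `Ω` is a component. The orbit is far away at times `n` and near `z₀` at
times `n + 1`, hence oscillates. If two images of `Ω` met, an accumulation point of the orbit in an
annulus about `z₀` would be fixed by some `F^[p]`, although `z₀` is an isolated fixed point of
`F^[p]`. Injectivity holds because the `n`-th iterates are nearly affine around `S k`. -/

/-! ### Normality, Fatou components and disjointness of the images -/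

/-- If a connected open set lies in the Fatou set and its frontier misses the Fatou set,
then it is a Fatou component. -/
theorem isFatouComponent_of_frontier {f : ℂ → ℂ} {Ω : Set ℂ} (hopen : IsOpen Ω)
    (hconn : IsConnected Ω) (hsub : Ω ⊆ fatouSet f)
    (hfr : ∀ p ∈ frontier Ω, p ∉ fatouSet f) : IsFatouComponent f Ω := by
  obtain ⟨p, hp⟩ := hconn.nonempty
  refine ⟨p, hsub hp, ?_⟩
  apply Set.Subset.antisymm
  · exact hconn.isPreconnected.subset_connectedComponentIn hp hsub
  · have hC : IsPreconnected (connectedComponentIn (fatouSet f) p) :=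
      isPreconnected_connectedComponentIn
    refine hC.subset_of_closure_inter_subset hopen
      ⟨p, mem_connectedComponentIn (hsub hp), hp⟩ ?_
    rintro z ⟨hz1, hz2⟩
    by_contra hz
    refine hfr z ⟨hz1, ?_⟩ (connectedComponentIn_subset _ _ hz2)
    rwa [hopen.interior_eq]

/-- A sequence of natural numbers either takes some value infinitely often or tends to infinity. -/
theorem exists_frequently_eq_or_tendsto_atTop (s : ℕ → ℕ) :
    (∃ n, ∃ᶠ k in atTop, s k = n) ∨ Tendsto s atTop atTop := by
  by_contra! h
  obtain ⟨h1, h2⟩ := h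
  apply h2
  rw [tendsto_atTop]
  intro b
  have : ∀ i ∈ Set.Iio b, ∀ᶠ k in atTop, s k ≠ i := fun i _ => h1 i
  have := (Filter.eventually_all_finite (Set.finite_Iio b)).2 this
  filter_upwards [this] with k hk
  by_contra! hlt
  exact hk (s k) hlt rfl

/-- If the diameters of the iterated images of a set tend to zero, then the iterates
form a normal family on that set. -/
theorem isNormalFamilyOn_of_diam {f : ℂ → ℂ} {Ω : Set ℂ}
    (hdiam : ∀ ε > 0, ∀ᶠ j in atTop, ∀ z ∈ Ω, ∀ w ∈ Ω, dist (f^[j] z) (f^[j] w) ≤ ε) :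
    IsNormalFamilyOn (fun n : ℕ => f^[n]) Ω := by
  intro s
  rcases Ω.eq_empty_or_nonempty with rfl | ⟨x, hx⟩
  · exact ⟨id, strictMono_id, Or.inl ⟨0, by simp [TendstoLocallyUniformlyOn]⟩⟩
  rcases exists_frequently_eq_or_tendsto_atTop s with ⟨n, hn⟩ | hs
  · obtain ⟨φ, hφ, hφn⟩ := extraction_of_frequently_atTop hn
    refine ⟨φ, hφ, Or.inl ⟨f^[n], ?_⟩⟩
    apply TendstoUniformlyOn.tendstoLocallyUniformlyOn
    rw [Metric.tendstoUniformlyOn_iff]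
    intro ε hε
    filter_upwards with k z _
    simp [hφn k, hε]
  -- Since the images shrink, the single orbit of `x` decides between a limit `∞` and a constant
  -- finite limit.
  · by_cases hb : Tendsto (fun k => ‖f^[s k] x‖) atTop atTop
    · refine ⟨id, strictMono_id, Or.inr ?_⟩
      intro K hK _ R
      have h1 := hs.eventually (hdiam 1 one_pos)
      filter_upwards [h1, hb.eventually_gt_atTop (R + 1)] with k hk1 hk2 z hz
      have := hk1 x hx z (hK hz)
      rw [dist_eq_norm] at this
      have h3 := norm_sub_norm_le (f^[s k] x) (f^[s k] z)
      simp only [id] at *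
      linarith
    · rw [tendsto_atTop] at hb
      push Not at hb
      obtain ⟨R, hR⟩ := hb
      have hfreq : ∃ᶠ k in atTop, f^[s k] x ∈ Metric.closedBall (0 : ℂ) R := by
        refine hR.mono fun k hk => ?_
        simpa using hk.le
      obtain ⟨a, -, φ, hφ, hφa⟩ :=
        tendsto_subseq_of_frequently_bounded Metric.isBounded_closedBall hfreq
      refine ⟨φ, hφ, Or.inl ⟨fun _ => a, ?_⟩⟩
      apply TendstoUniformlyOn.tendstoLocallyUniformlyOn
      rw [Metric.tendstoUniformlyOn_iff]
      intro ε hε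
      have h1 := (hs.comp hφ.tendsto_atTop).eventually (hdiam (ε / 2) (half_pos hε))
      have h2 := Metric.tendsto_nhds.1 hφa (ε / 2) (half_pos hε)
      filter_upwards [h1, h2] with k hk1 hk2 z hz
      have := hk1 x hx z hz
      have h4 := dist_triangle a (f^[s (φ k)] x) (f^[s (φ k)] z)
      rw [dist_comm a (f^[s (φ k)] x)] at h4
      simp only [Function.comp] at *
      linarith

/-- A point which is a limit both of points whose orbits tend to `∞` along a common
sequence of times and of points with bounded orbits is not in the Fatou set. -/
theorem notMem_fatouSet {f : ℂ → ℂ} {p : ℂ} {φ : ℕ → ℕ}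
    (h : ∀ U : Set ℂ, IsOpen U → p ∈ U →
      (∃ x ∈ U, Tendsto (fun k => ‖f^[φ k] x‖) atTop atTop) ∧
      ∃ a ∈ U, ∃ C : ℝ, ∀ᶠ k in atTop, ‖f^[φ k] a‖ ≤ C) : p ∉ fatouSet f := by
  rintro ⟨U, hU, hpU, hN⟩
  obtain ⟨⟨x, hxU, hx⟩, a, haU, C, ha⟩ := h U hU hpU
  obtain ⟨ψ, hψ, ⟨g, hg⟩ | hinf⟩ := hN φ
  · have h1 := (hg.tendsto_at hxU).norm
    exact not_tendsto_nhds_of_tendsto_atTop (hx.comp hψ.tendsto_atTop) _ h1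
  · have h1 := hinf {a} (by simpa using haU) isCompact_singleton C
    obtain ⟨k, hk1, hk2⟩ := (h1.and (hψ.tendsto_atTop.eventually ha)).exists
    have := hk1 a rfl
    linarith

/-- If the iterated images of a set shrink, and its orbit both accumulates at a repelling fixed
point of multiplier `2` and leaves every bounded set along a subsequence, then its images
are pairwise disjoint. -/
theorem not_isPreperiodicSet {f : ℂ → ℂ} (hf : Differentiable ℂ f) {Ω : Set ℂ} {c : ℂ}
    (hc : f c = c) (hdc : deriv f c = 2)
    (hdiam : ∀ ε > 0, ∀ᶠ j in atTop, ∀ z ∈ Ω, ∀ w ∈ Ω, dist (f^[j] z) (f^[j] w) ≤ ε)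
    (hnear : ∀ x ∈ Ω, ∀ ε > 0, ∃ᶠ j in atTop, dist (f^[j] x) c < ε)
    (hfar : ∀ x ∈ Ω, ∀ R : ℝ, ∃ᶠ j in atTop, R < dist (f^[j] x) c) :
    ¬ IsPreperiodicSet f Ω := by
  rintro ⟨n, m, hnm, hne⟩
  wlog hlt : n < m generalizing n m
  · exact this m n hnm.symm (by rwa [Set.inter_comm]) (by omega)
  obtain ⟨_, ⟨x, hx, rfl⟩, y, hy, hxy⟩ := hne
  obtain ⟨p, rfl⟩ : ∃ p, m = p + n := ⟨m - n, by omega⟩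
  have hp : p ≠ 0 := by omega
  -- the fixed point `c` of `f^[p]` is isolated
  have hder : HasDerivAt f^[p] (2 ^ p) c := by
    have := HasDerivAt.iterate (f := f) (x := c) (f' := 2) (hdc ▸ (hf c).hasDerivAt) hc p
    exact this
  have hsub : HasDerivAt (fun z => f^[p] z - z) (2 ^ p - 1) c := hder.sub (hasDerivAt_id c)
  have h2p : (2 : ℂ) ^ p - 1 ≠ 0 := by
    intro h
    have h1 : ‖(2 : ℂ) ^ p‖ = 1 := by rw [sub_eq_zero.1 h]; simp
    rw [norm_pow, Complex.norm_ofNat] at h1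
    have := (pow_eq_one_iff_of_nonneg (by norm_num) hp).1 h1
    norm_num at this
  have hiso := hsub.eventually_ne (c := 0) h2p
  -- The constant is `3 = 2 + 1`, multiplier plus error. One step from inside radius `r / 3`
  -- therefore stays within radius `r`, so an orbit leaving the small disc must land in the annulus.
  have hgrow : ∀ᶠ z in 𝓝 c, dist (f z) c ≤ 3 * dist z c := by
    have h1 : HasDerivAt f 2 c := hdc ▸ (hf c).hasDerivAt
    have := (hasDerivAt_iff_isLittleO.1 h1).def one_pos
    filter_upwards [this] with z hz
    rw [hc, one_mul] at hz
    rw [dist_eq_norm, dist_eq_norm]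
    calc ‖f z - c‖ = ‖(f z - c - (z - c) • 2) + (z - c) * 2‖ := by congr 1; simp
      _ ≤ ‖z - c‖ + ‖z - c‖ * 2 := by
        refine (norm_add_le _ _).trans (add_le_add hz ?_)
        simp
      _ = _ := by ring
  rw [eventually_nhdsWithin_iff] at hiso
  obtain ⟨r, hr, hr'⟩ := Metric.nhds_basis_closedBall.eventually_iff.1 (hiso.and hgrow)
  -- the orbit visits an annulus infinitely often
  have hann : ∃ᶠ j in atTop, f^[j] (f^[n] x) ∈ Metric.closedBall c r \ Metric.ball c (r / 3) := by
    rw [frequently_atTop]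
    intro J
    obtain ⟨j1, hj1, hj1'⟩ := (frequently_atTop.1 (hnear x hx (r / 3) (by positivity))) (J + n)
    obtain ⟨j2, hj2, hj2'⟩ := (frequently_atTop.1 (hfar x hx r)) j1
    have hex : ∃ i, r / 3 ≤ dist (f^[i] (f^[j1] x)) c := by
      refine ⟨j2 - j1, ?_⟩
      rw [← Function.iterate_add_apply, Nat.sub_add_cancel hj2]
      linarith
    classical
    have hspec := Nat.find_spec hex
    have hmin := fun i hi => Nat.find_min hex (m := i) hi
    set i := Nat.find hex
    have hi0 : i ≠ 0 := by
      intro h0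
      rw [h0] at hspec
      simp only [Function.iterate_zero, id] at hspec
      linarith
    obtain ⟨i', hi'⟩ := Nat.exists_eq_succ_of_ne_zero hi0
    have hlt' := hmin i' (by omega)
    push Not at hlt'
    refine ⟨i + (j1 - n), by omega, ?_⟩
    rw [← Function.iterate_add_apply, show i + (j1 - n) + n = i + j1 by omega,
      Function.iterate_add_apply]
    refine ⟨?_, by simpa using hspec⟩
    rw [hi', Function.iterate_succ_apply', Metric.mem_closedBall]
    have := (hr' (x := f^[i'] (f^[j1] x)) (by rw [Metric.mem_closedBall]; linarith)).2
    linarith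
  obtain ⟨φ, hφ, hφa⟩ := extraction_of_frequently_atTop hann
  have hcpt : IsCompact (Metric.closedBall c r \ Metric.ball c (r / 3)) :=
    (isCompact_closedBall c r).diff Metric.isOpen_ball
  obtain ⟨u, hu, ψ, hψ, hlim⟩ := hcpt.tendsto_subseq hφa
  have hfp : f^[p] u = u := by
    have h1 : Tendsto (fun k => f^[p] (f^[φ (ψ k)] (f^[n] x))) atTop (𝓝 (f^[p] u)) :=
      ((hf.continuous.iterate p).tendsto u).comp hlim
    -- The two points are images of `y` and of `x` under the same iterate, of order `j + p + n` with
    -- `j = φ (ψ k)`, because `f^[p + n] y = f^[n] x`.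
    have h2 : Tendsto (fun k => dist (f^[φ (ψ k)] (f^[n] x))
        (f^[p] (f^[φ (ψ k)] (f^[n] x)))) atTop (𝓝 0) := by
      rw [Metric.tendsto_nhds]
      intro ε hε
      have h3 := (tendsto_add_atTop_nat (p + n)).comp
        (hφ.tendsto_atTop.comp hψ.tendsto_atTop)
      filter_upwards [h3.eventually (hdiam (ε / 2) (half_pos hε))] with k hk
      have h4 := hk y hy x hx
      simp only [Function.comp] at h4
      rw [Function.iterate_add_apply, hxy, ← add_assoc, Function.iterate_add_apply _ _ n,
        add_comm, Function.iterate_add_apply _ p] at h4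
      rw [Real.dist_0_eq_abs, abs_of_nonneg dist_nonneg]
      linarith
    have h3 := hlim.dist h1
    have := tendsto_nhds_unique h2 h3
    exact (dist_eq_zero.1 this.symm).symm
  have huc : u ≠ c := by
    rintro rfl
    exact hu.2 (Metric.mem_ball_self (by positivity))
  exact (hr' hu.1).1 huc (by rw [hfp, sub_self])

/-! ### The Cauchy–Pompeiu formula -/

/-- The Wirtinger derivative of `u` with respect to the conjugate variable. -/
noncomputable def dbar (u : ℂ → ℂ) (w : ℂ) : ℂ :=
  (fderiv ℝ u w 1 + Complex.I * fderiv ℝ u w Complex.I) / 2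

theorem continuous_dbar {u : ℂ → ℂ} (hu : ContDiff ℝ 1 u) : Continuous (dbar u) := by
  have := hu.continuous_fderiv one_ne_zero
  unfold dbar
  fun_prop

theorem dbar_eq_zero_of_eventuallyEq {u g : ℂ → ℂ} {w : ℂ} (h : u =ᶠ[𝓝 w] g)
    (hg : DifferentiableAt ℂ g w) : dbar u w = 0 := by
  unfold dbar
  have hI : fderiv ℂ g w Complex.I = Complex.I * fderiv ℂ g w 1 := by
    rw [← smul_eq_mul, ← map_smul]; simp
  rw [h.fderiv_eq, hg.fderiv_restrictScalars ℝ]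
  simp only [ContinuousLinearMap.coe_restrictScalars', hI]
  rw [← mul_assoc, Complex.I_mul_I]
  ring

/-- The point of the unit circle with argument `θ`. -/
noncomputable def unitCirclePoint (θ : ℝ) : ℂ := Real.cos θ + Real.sin θ * Complex.I

theorem continuous_unitCirclePoint : Continuous unitCirclePoint := by
  unfold unitCirclePoint
  fun_prop

theorem norm_unitCirclePoint (θ : ℝ) : ‖unitCirclePoint θ‖ = 1 := by
  unfold unitCirclePoint
  push_cast
  rw [Complex.norm_cos_add_sin_mul_I]

theorem hasDerivAt_unitCirclePoint (θ : ℝ) :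
    HasDerivAt unitCirclePoint (Complex.I * unitCirclePoint θ) θ := by
  have h1 := (Real.hasDerivAt_cos θ).ofReal_comp
  have h2 := ((Real.hasDerivAt_sin θ).ofReal_comp).mul_const Complex.I
  refine (h1.add h2).congr_deriv ?_
  unfold unitCirclePoint
  push_cast
  linear_combination -(Complex.sin θ) * Complex.I_mul_I

/-- The Cauchy–Pompeiu formula for compactly supported functions, at the origin. -/
theorem integral_dbar_div {u : ℂ → ℂ} (hu : ContDiff ℝ 1 u) (hc : HasCompactSupport u) :
    ∫ w, dbar u w / w = -(Real.pi : ℂ) * u 0 := by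
  have hcont := hu.continuous_fderiv one_ne_zero
  have hE := continuous_unitCirclePoint
  set A : ℝ × ℝ → ℂ := fun p =>
    fderiv ℝ u (p.1 * unitCirclePoint p.2) (unitCirclePoint p.2) with hA
  set B : ℝ × ℝ → ℂ := fun p => fderiv ℝ u (p.1 * unitCirclePoint p.2)
    (Complex.I * unitCirclePoint p.2) with hB
  have hAc : Continuous A := by fun_prop
  have hBc : Continuous B := by fun_prop
  obtain ⟨R, hR⟩ := hc.isCompact.isBounded.subset_closedBall (0 : ℂ)
  have hzero : ∀ w : ℂ, R < ‖w‖ → fderiv ℝ u w = 0 := by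
    intro w hw
    by_contra hne
    have := hR (support_fderiv_subset ℝ (f := u) hne)
    simp at this
    linarith
  have hinteg : ∀ G : ℝ × ℝ → ℂ, Continuous G → (∀ p : ℝ × ℝ, R < |p.1| → G p = 0) →
      MeasureTheory.IntegrableOn G (Set.Ioi 0 ×ˢ Set.Ioo (-Real.pi) Real.pi) := by
    intro G hG hG0
    have h1 : MeasureTheory.IntegrableOn G (Set.Icc 0 R ×ˢ Set.Icc (-Real.pi) Real.pi) :=
      hG.continuousOn.integrableOn_compact (isCompact_Icc.prod isCompact_Icc)
    refine h1.of_forall_sdiff_eq_zero (measurableSet_Ioi.prod measurableSet_Ioo) ?_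
    rintro ⟨r, θ⟩ ⟨⟨h2, h3⟩, h4⟩
    apply hG0
    by_contra! h5
    exact h4 ⟨⟨(Set.mem_Ioi.1 h2).le, (le_abs_self _).trans h5⟩, Set.Ioo_subset_Icc_self h3⟩
  have hnorm : ∀ p : ℝ × ℝ, ‖(p.1 : ℂ) * unitCirclePoint p.2‖ = |p.1| := by
    intro p; rw [norm_mul, norm_unitCirclePoint]; simp
  have hAi := hinteg A hAc (fun p hp => by simp [hA, hzero _ (by rw [hnorm p]; exact hp)])
  have hBi := hinteg B hBc (fun p hp => by simp [hB, hzero _ (by rw [hnorm p]; exact hp)])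
  -- In polar coordinates the integrand is half of `∂u/∂r + (i / r) ∂u/∂θ`. The angular part `B`
  -- integrates to zero by periodicity, the radial part `A` to `-u 0` along each ray.
  have hstep : ∀ p ∈ Set.Ioi (0 : ℝ) ×ˢ Set.Ioo (-Real.pi) Real.pi,
      p.1 • (dbar u (Complex.polarCoord.symm p) / Complex.polarCoord.symm p) =
        (1 / 2 : ℂ) * (A p + Complex.I * B p) := by
    rintro ⟨r, θ⟩ ⟨hr, -⟩
    have hr' : (r : ℂ) ≠ 0 := by exact_mod_cast (Set.mem_Ioi.1 hr).ne'
    have hE0 : unitCirclePoint θ ≠ 0 := by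
      intro h; have := norm_unitCirclePoint θ; rw [h] at this; simp at this
    have hsymm : Complex.polarCoord.symm (r, θ) = r * unitCirclePoint θ := by
      rw [Complex.polarCoord_symm_apply]; rfl
    rw [hsymm]
    set L := fderiv ℝ u (r * unitCirclePoint θ) with hL
    have hlin : ∀ x y : ℝ, L (x + y * Complex.I) = x * L 1 + y * L Complex.I := by
      intro x y
      have : (x + y * Complex.I : ℂ) = x • (1 : ℂ) + y • Complex.I := by simp
      rw [this, map_add, map_smul, map_smul]; simp
    have h1 : A (r, θ) = Real.cos θ * L 1 + Real.sin θ * L Complex.I := hlin _ _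
    have h2 : B (r, θ) = -Real.sin θ * L 1 + Real.cos θ * L Complex.I := by
      have : Complex.I * unitCirclePoint θ = ((-Real.sin θ : ℝ) : ℂ) +
          (Real.cos θ : ℝ) * Complex.I := by
        unfold unitCirclePoint
        push_cast
        linear_combination (Complex.sin θ) * Complex.I_mul_I
      change L (Complex.I * unitCirclePoint θ) = _
      rw [this, hlin]
      push_cast
      ring
    rw [h1, h2, Complex.real_smul]
    unfold dbar
    rw [← hL]
    field_simp
    unfold unitCirclePoint
    have hcs : (Real.cos θ : ℂ) ^ 2 + (Real.sin θ : ℂ) ^ 2 = 1 := by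
      exact_mod_cast Real.cos_sq_add_sin_sq θ
    have hI := Complex.I_mul_I
    linear_combination (-(L 1 + Complex.I * L Complex.I)) * hcs +
      ((Real.sin θ : ℂ) ^ 2 * L 1
        - (Real.sin θ : ℂ) * (Real.cos θ : ℂ) * L Complex.I) * hI
  rw [← Complex.integral_comp_polarCoord_symm]
  rw [show polarCoord.target = Set.Ioi (0 : ℝ) ×ˢ Set.Ioo (-Real.pi) Real.pi from rfl]
  rw [MeasureTheory.setIntegral_congr_fun (measurableSet_Ioi.prod measurableSet_Ioo) hstep,
    MeasureTheory.integral_const_mul, MeasureTheory.integral_add hAi (hBi.const_mul _),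
    MeasureTheory.integral_const_mul]
  have hBint : ∫ p in Set.Ioi (0 : ℝ) ×ˢ Set.Ioo (-Real.pi) Real.pi, B p = 0 := by
    rw [MeasureTheory.Measure.volume_eq_prod, MeasureTheory.setIntegral_prod _ hBi]
    apply MeasureTheory.integral_eq_zero_of_ae
    filter_upwards [MeasureTheory.ae_restrict_mem measurableSet_Ioi] with r hr
    have hr' : (r : ℂ) ≠ 0 := by exact_mod_cast (Set.mem_Ioi.1 hr).ne'
    have hder : ∀ θ : ℝ, HasDerivAt (fun θ => (r : ℂ)⁻¹ * u (r * unitCirclePoint θ))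
        (B (r, θ)) θ := by
      intro θ
      have h1 := (hasDerivAt_unitCirclePoint θ).const_mul (r : ℂ)
      have h2 := ((hu.differentiable one_ne_zero _).hasFDerivAt).comp_hasDerivAt θ h1
      refine (h2.const_mul (r : ℂ)⁻¹).congr_deriv ?_
      rw [← Complex.real_smul (x := r) (z := Complex.I * _), map_smul, Complex.real_smul,
        inv_mul_cancel_left₀ hr']
    rw [← MeasureTheory.integral_Ioc_eq_integral_Ioo,
      ← intervalIntegral.integral_of_le (by linarith [Real.pi_pos]),
      intervalIntegral.integral_eq_sub_of_hasDerivAt (fun θ _ => hder θ)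
        ((hBc.comp (by fun_prop : Continuous fun θ : ℝ => (r, θ))).intervalIntegrable _ _)]
    simp [unitCirclePoint]
  have hAint : ∫ p in Set.Ioi (0 : ℝ) ×ˢ Set.Ioo (-Real.pi) Real.pi, A p =
      -(2 * Real.pi) * u 0 := by
    rw [MeasureTheory.Measure.volume_eq_prod, ← MeasureTheory.setIntegral_prod_swap,
      MeasureTheory.setIntegral_prod _ (by
        rw [← Set.preimage_swap_prod]
        exact (MeasureTheory.Measure.measurePreserving_swap.integrableOn_comp_preimage
          (MeasurableEquiv.prodComm.measurableEmbedding)).2 hAi)]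
    have : ∀ θ : ℝ, ∫ r in Set.Ioi (0 : ℝ), A (Prod.swap (θ, r)) = - u 0 := by
      intro θ
      have hder : ∀ r : ℝ, HasDerivAt (fun r : ℝ => u (r * unitCirclePoint θ)) (A (r, θ)) r := by
        intro r
        have h1 : HasDerivAt (fun r : ℝ => (r : ℂ) * unitCirclePoint θ) (unitCirclePoint θ) r := by
          simpa using ((hasDerivAt_id r).ofReal_comp).mul_const (unitCirclePoint θ)
        exact ((hu.differentiable one_ne_zero _).hasFDerivAt).comp_hasDerivAt r h1
      have htend : Tendsto (fun r : ℝ => u (r * unitCirclePoint θ)) atTop (𝓝 0) := by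
        refine tendsto_const_nhds.congr' ?_
        filter_upwards [eventually_gt_atTop R, eventually_ge_atTop 0] with r hr hr0
        by_contra hne
        have := hR (subset_tsupport u (Ne.symm hne : u _ ≠ 0))
        rw [mem_closedBall_zero_iff, hnorm (r, θ), abs_of_nonneg hr0] at this
        linarith
      have hint : MeasureTheory.IntegrableOn (fun r => A (r, θ)) (Set.Ioi 0) := by
        have hc1 : Continuous fun r => A (r, θ) := hAc.comp (by fun_prop)
        have h1 : MeasureTheory.IntegrableOn (fun r => A (r, θ)) (Set.Icc 0 R) :=
          hc1.continuousOn.integrableOn_compact isCompact_Icc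
        refine h1.of_forall_sdiff_eq_zero measurableSet_Ioi ?_
        rintro r ⟨h2, h4⟩
        have : R < |r| := by
          by_contra! h5
          exact h4 ⟨(Set.mem_Ioi.1 h2).le, (le_abs_self _).trans h5⟩
        simp [hA, hzero _ (by rw [hnorm (r, θ)]; exact this)]
      have := MeasureTheory.integral_Ioi_of_hasDerivAt_of_tendsto' (a := 0)
        (fun r _ => hder r) hint htend
      simpa using this
    simp_rw [this]
    rw [MeasureTheory.setIntegral_const]
    rw [Real.volume_real_Ioo_of_le (by linarith [Real.pi_pos]), Complex.real_smul]
    push_cast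
    ring
  rw [hAint, hBint]
  ring

/-! ### Runge's theorem -/

/-- `g` can be approximated uniformly on `K` by entire functions. -/
def EntireApprox (K : Set ℂ) (g : ℂ → ℂ) : Prop :=
  ∀ ε > 0, ∃ p : ℂ → ℂ, Differentiable ℂ p ∧ ∀ z ∈ K, ‖p z - g z‖ < ε

/-- The restrictions of entire functions to `K`. -/
def entireSubalgebra (K : Set ℂ) : Subalgebra ℂ C(K, ℂ) where
  carrier := {φ | ∃ p : ℂ → ℂ, Differentiable ℂ p ∧ ∀ z : K, φ z = p z}
  mul_mem' := by
    rintro a b ⟨p, hp, hp'⟩ ⟨q, hq, hq'⟩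
    exact ⟨p * q, hp.mul hq, fun z => by simp [hp', hq']⟩
  add_mem' := by
    rintro a b ⟨p, hp, hp'⟩ ⟨q, hq, hq'⟩
    exact ⟨p + q, hp.add hq, fun z => by simp [hp', hq']⟩
  algebraMap_mem' := fun c => ⟨fun _ => c, differentiable_const c, fun z => rfl⟩

section Runge

variable {K : Set ℂ} [CompactSpace K]

/-- The geometric series converges in norm, and its partial sums lie in the closed subalgebra. -/
theorem inverse_one_sub_mem {x : C(K, ℂ)} (hx : x ∈ (entireSubalgebra K).topologicalClosure)
    (hx1 : ‖x‖ < 1) :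
    ∃ y ∈ (entireSubalgebra K).topologicalClosure, ∀ z : K, y z * (1 - x z) = 1 := by
  refine ⟨∑' i, x ^ i, ?_, fun z => ?_⟩
  · refine (Subalgebra.isClosed_topologicalClosure _).mem_of_tendsto
      (summable_geometric_of_norm_lt_one hx1).hasSum (Eventually.of_forall fun s => ?_)
    exact Subalgebra.sum_mem _ fun i _ => Subalgebra.pow_mem _ hx i
  · have := geom_series_mul_neg x hx1
    have := congrArg (fun h : C(K, ℂ) => h z) this
    simpa using this

/-- `z ↦ 1 / (z - w)` is a uniform limit on `K` of entire functions. -/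
def IsPoleApprox (K : Set ℂ) [CompactSpace K] (w : ℂ) : Prop :=
  ∃ φ ∈ (entireSubalgebra K).topologicalClosure, ∀ z : K, φ z * (z - w) = 1

/-- Since `z - w' = (z - w) * (1 - (w' - w) * φ z)`, inverting the second factor by a geometric
series moves the pole from `w` to `w'`. -/
theorem IsPoleApprox.of_norm_lt {φ : C(K, ℂ)} {w w' : ℂ}
    (hφ : φ ∈ (entireSubalgebra K).topologicalClosure)
    (h : ∀ z : K, φ z * (z - w) = 1) (hw : ‖w' - w‖ * ‖φ‖ < 1) : IsPoleApprox K w' := by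
  obtain ⟨y, hy, hy'⟩ := inverse_one_sub_mem
    (x := (w' - w) • φ) (Subalgebra.smul_mem _ hφ _) (by rwa [norm_smul])
  refine ⟨φ * y, Subalgebra.mul_mem _ hφ hy, fun z => ?_⟩
  have h1 := h z
  have h2 := hy' z
  simp only [ContinuousMap.mul_apply, ContinuousMap.smul_apply, smul_eq_mul] at *
  linear_combination h2 + (y z) * h1

/-- Pole pushing: the set of admissible poles is open, contains a point far from `K`, and is
relatively closed in the complement of `K`. Connectedness then makes it contain the whole
complement. -/
theorem isPoleApprox_of_notMem (hconn : IsPreconnected Kᶜ) {w : ℂ} (hw : w ∉ K) :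
    IsPoleApprox K w := by
  have hK : IsCompact K := isCompact_iff_compactSpace.2 inferInstance
  have hopen : IsOpen {w | IsPoleApprox K w} := by
    rw [Metric.isOpen_iff]
    rintro w ⟨φ, hφ, h⟩
    refine ⟨1 / (‖φ‖ + 1), by positivity, fun w' hw' => IsPoleApprox.of_norm_lt hφ h ?_⟩
    rw [Metric.mem_ball, dist_eq_norm, lt_div_iff₀ (by positivity)] at hw'
    nlinarith [norm_nonneg (w' - w)]
  suffices Kᶜ ⊆ {w | IsPoleApprox K w} from this hw
  refine hconn.subset_of_closure_inter_subset hopen ?_ ?_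
  · obtain ⟨M, hM0, hM⟩ := hK.isBounded.exists_pos_norm_lt
    have hnot : (M : ℂ) ∉ K := fun h => by
      have := hM _ h
      simp [abs_of_pos hM0] at this
    refine ⟨M, hnot, ?_⟩
    have hM0' : (M : ℂ) ≠ 0 := by exact_mod_cast hM0.ne'
    obtain ⟨y, hy, hy'⟩ := inverse_one_sub_mem (K := K)
      (x := (M : ℂ)⁻¹ • ContinuousMap.mk (fun z : K => (z : ℂ)) continuous_subtype_val)
      (Subalgebra.smul_mem _ (Subalgebra.le_topologicalClosure _
        (show _ ∈ entireSubalgebra K from ⟨id, differentiable_id, fun z => rfl⟩)) _) (by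
        rw [ContinuousMap.norm_lt_iff _ one_pos]
        intro z
        have := hM z z.2
        simp only [ContinuousMap.smul_apply, ContinuousMap.coe_mk, smul_eq_mul, norm_mul, norm_inv,
          Complex.norm_real, Real.norm_eq_abs, abs_of_pos hM0]
        rw [inv_mul_lt_iff₀ hM0]
        linarith)
    refine ⟨-(M : ℂ)⁻¹ • y, Subalgebra.smul_mem _ hy _, fun z => ?_⟩
    have := hy' z
    simp only [ContinuousMap.smul_apply, smul_eq_mul, ContinuousMap.coe_mk] at *
    field_simp at this ⊢
    linear_combination this
  · rintro w ⟨hwc, hwK⟩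
    obtain ⟨d, hd, hdK⟩ : ∃ d > 0, ∀ z ∈ K, d ≤ dist z w := by
      obtain ⟨d, hd, hb⟩ := Metric.isOpen_iff.1 hK.isClosed.isOpen_compl w hwK
      exact ⟨d, hd, fun z hz => by by_contra! h; exact hb h hz⟩
    -- With `w'` within `d / 3` of `w`, the set `K` is at distance at least `2 * d / 3` from `w'`,
    -- so the series has ratio at most `1 / 2`.
    obtain ⟨w', ⟨φ, hφ, h⟩, hww'⟩ := Metric.mem_closure_iff.1 hwc (d / 3) (by positivity)
    refine IsPoleApprox.of_norm_lt hφ h ?_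
    have hnorm : ‖φ‖ ≤ 3 / (2 * d) := by
      rw [ContinuousMap.norm_le _ (by positivity)]
      intro z
      have h1 : ‖φ z‖ * ‖(z : ℂ) - w'‖ = 1 := by rw [← norm_mul, h z, norm_one]
      have h2 : 2 * d / 3 ≤ ‖(z : ℂ) - w'‖ := by
        have := hdK z z.2
        have h3 := dist_triangle (z : ℂ) w' w
        rw [dist_comm w' w] at h3
        rw [← dist_eq_norm]
        linarith
      rw [le_div_iff₀ (by positivity)]
      nlinarith [norm_nonneg (φ z)]
    rw [dist_eq_norm] at hww'
    calc ‖w - w'‖ * ‖φ‖ ≤ d / 3 * (3 / (2 * d)) := by gcongr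
      _ < 1 := by field_simp; norm_num

/-- The quotient map by `s` commutes with the integral and annihilates the integrand. -/
theorem integral_mem_of_isClosed {X E : Type*} [MeasurableSpace X] {μ : MeasureTheory.Measure X}
    [NormedAddCommGroup E] [NormedSpace ℂ E] [CompleteSpace E] {s : Submodule ℂ E}
    (hs : IsClosed (s : Set E)) {F : X → E} (hF : MeasureTheory.Integrable F μ)
    (hmem : ∀ x, F x ∈ s) : ∫ x, F x ∂μ ∈ s := by
  have : IsClosed (s.toAddSubgroup : Set E) := hs
  have h1 := ContinuousLinearMap.integral_comp_comm (𝕜 := ℂ) (s.mkQL) hF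
  have h2 : ∀ x, s.mkQL (F x) = 0 := fun x => (Submodule.Quotient.mk_eq_zero s).2 (hmem x)
  simp only [h2, MeasureTheory.integral_zero] at h1
  exact (Submodule.Quotient.mk_eq_zero s).1 h1.symm

end Runge

open scoped Manifold in
/-- A function holomorphic near a compact set agrees near that set with a compactly supported
continuously differentiable function. -/
theorem exists_contDiff_hasCompactSupport_eventuallyEq {K U : Set ℂ} (hK : IsCompact K)
    (hU : IsOpen U) (hKU : K ⊆ U) {g : ℂ → ℂ} (hg : DifferentiableOn ℂ g U) :
    ∃ u : ℂ → ℂ, ContDiff ℝ 1 u ∧ HasCompactSupport u ∧ ∃ V, IsOpen V ∧ K ⊆ V ∧ V ⊆ U ∧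
      Set.EqOn u g V := by
  obtain ⟨L, hL, hKL, hLU⟩ := exists_compact_between hK hU hKU
  obtain ⟨χ, hχ0, hχ1, -⟩ := exists_contMDiffMap_zero_one_nhds_of_isClosed (n := 1) 𝓘(ℝ, ℂ)
    (s := (interior L)ᶜ) (t := K) isOpen_interior.isClosed_compl hK.isClosed
    (Set.disjoint_compl_left_iff_subset.2 hKL)
  obtain ⟨V, hVo, hKV, hV⟩ := mem_nhdsSet_iff_exists.1 hχ1
  obtain ⟨W, hWo, hLW, hW⟩ := mem_nhdsSet_iff_exists.1 hχ0
  have hχ : ContDiff ℝ 1 χ := χ.contMDiff.contDiff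
  refine ⟨fun z => (χ z : ℂ) * g z, ?_, ?_, V ∩ U, hVo.inter hU, Set.subset_inter hKV hKU,
    Set.inter_subset_right, fun z hz => ?_⟩
  · rw [contDiff_iff_contDiffAt]
    intro z
    by_cases hz : z ∈ L
    · have h1 : ContDiffAt ℝ 1 g z :=
        ((hg.contDiffOn hU).contDiffAt (hU.mem_nhds (hLU hz))).restrict_scalars ℝ
      exact (Complex.ofRealCLM.contDiff.comp hχ).contDiffAt.mul h1
    · have hzW : z ∈ W := hLW fun h => hz (interior_subset h)
      refine (contDiffAt_const (c := (0 : ℂ))).congr_of_eventuallyEq ?_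
      filter_upwards [hWo.mem_nhds hzW] with w hw
      have : χ w = 0 := hW hw
      simp [this]
  · refine HasCompactSupport.intro hL fun z hz => ?_
    have : χ z = 0 := hW (hLW fun h => hz (interior_subset h))
    simp [this]
  · have : χ z = 1 := hV hz.1
    simp [this]

/-- **Runge's theorem**: a function holomorphic near a compact set with connected complement is
a uniform limit on that set of entire functions. -/
theorem entireApprox_of_differentiableOn {K U : Set ℂ} (hK : IsCompact K)
    (hconn : IsPreconnected Kᶜ) (hU : IsOpen U) (hKU : K ⊆ U) {g : ℂ → ℂ}
    (hg : DifferentiableOn ℂ g U) : EntireApprox K g := by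
  have := isCompact_iff_compactSpace.1 hK
  obtain ⟨u, hu, huc, V, hV, hKV, hVU, hug⟩ :=
    exists_contDiff_hasCompactSupport_eventuallyEq hK hU hKU hg
  have hk0 : ∀ w ∈ V, dbar u w = 0 := fun w hw =>
    dbar_eq_zero_of_eventuallyEq (hug.eventuallyEq_of_mem (hV.mem_nhds hw))
      (hg.differentiableAt (hU.mem_nhds (hVU hw)))
  have hkc : Continuous (dbar u) := continuous_dbar hu
  have hks : HasCompactSupport (dbar u) := by
    refine HasCompactSupport.intro huc fun w hw => ?_
    have : fderiv ℝ u w = 0 := by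
      by_contra hne
      exact hw (support_fderiv_subset ℝ (f := u) hne)
    simp [dbar, this]
  -- The kernel is singular only where `p.1 = p.2`; such points lie in `V`, where `dbar u` vanishes.
  have hFc : Continuous fun p : ℂ × K => dbar u p.1 / (p.1 - p.2) := by
    rw [continuous_iff_continuousAt]
    rintro ⟨w, z⟩
    by_cases hw : w ∈ V
    · refine (continuousAt_const (y := (0 : ℂ))).congr ?_
      have : (Prod.fst : ℂ × K → ℂ) ⁻¹' V ∈ 𝓝 (w, z) :=
        (hV.preimage continuous_fst).mem_nhds hw
      filter_upwards [this] with p hp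
      simp [hk0 p.1 hp]
    · refine ContinuousAt.div (by fun_prop) (by fun_prop) ?_
      intro h
      have h' : w = z := sub_eq_zero.1 h
      exact hw (h' ▸ hKV z.2)
  let F : C(ℂ, C(K, ℂ)) := ContinuousMap.curry ⟨_, hFc⟩
  have hFapp : ∀ w (z : K), F w z = dbar u w / (w - z) := fun w z => rfl
  have hFs : HasCompactSupport F := by
    refine HasCompactSupport.intro hks fun w hw => ?_
    ext z
    rw [hFapp, image_eq_zero_of_notMem_tsupport hw]
    simp
  have hFi : MeasureTheory.Integrable F := F.continuous.integrable_of_hasCompactSupport hFs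
  -- The Cauchy–Pompeiu integral is read as an integral with values in `C(K, ℂ)`. Each value is a
  -- multiple of a Cauchy kernel with pole off `K`, so no Riemann sums are needed.
  have hmem : ∫ w, F w ∈ Subalgebra.toSubmodule (entireSubalgebra K).topologicalClosure := by
    refine integral_mem_of_isClosed
      (Subalgebra.isClosed_topologicalClosure (entireSubalgebra K)) hFi fun w => ?_
    by_cases hw : w ∈ V
    · have : F w = 0 := by
        ext z
        simp [hFapp, hk0 w hw]
      rw [this]
      exact Submodule.zero_mem _
    · obtain ⟨φ, hφ, hφw⟩ := isPoleApprox_of_notMem hconn fun h => hw (hKV h)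
      have : F w = (-dbar u w) • φ := by
        ext z
        have h1 := hφw z
        have h2 : (w : ℂ) - z ≠ 0 := by
          intro h
          exact hw (sub_eq_zero.1 h ▸ hKV z.2)
        rw [hFapp, div_eq_iff h2]
        simp only [ContinuousMap.smul_apply, smul_eq_mul]
        linear_combination -dbar u w * h1
      rw [this]
      exact Subalgebra.smul_mem _ hφ _
  have hval : ∀ z : K, (∫ w, F w) z = -(Real.pi : ℂ) * g z := by
    intro z
    have h1 : (∫ w, F w) z = ∫ w, F w z :=
      ((ContinuousMap.evalCLM ℂ z).integral_comp_comm hFi).symm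
    rw [h1]
    have h2 := MeasureTheory.integral_add_right_eq_self (μ := MeasureTheory.volume)
      (fun w => F w z) (z : ℂ)
    rw [← h2]
    have h3 : ContDiff ℝ 1 fun w => u (w + z) := hu.comp (contDiff_id.add contDiff_const)
    have h4 : HasCompactSupport fun w => u (w + z) :=
      huc.comp_homeomorph (Homeomorph.addRight (z : ℂ))
    have h5 := integral_dbar_div h3 h4
    have h6 : ∀ w, dbar (fun w => u (w + z)) w = dbar u (w + z) := by
      intro w
      unfold dbar
      rw [fderiv_comp_add_right]
    simp only [h6, zero_add, hug (hKV z.2)] at h5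
    rw [← h5]
    refine MeasureTheory.integral_congr_ae (Eventually.of_forall fun w => ?_)
    simp [hFapp]
  intro ε hε
  have hcl : ∫ w, F w ∈ closure (entireSubalgebra K : Set C(K, ℂ)) := hmem
  obtain ⟨φ, ⟨p, hp, hpφ⟩, hφd⟩ := Metric.mem_closure_iff.1 hcl (Real.pi * ε) (by positivity)
  refine ⟨fun z => -(Real.pi : ℂ)⁻¹ * p z, hp.const_mul _, fun z hz => ?_⟩
  have h1 : dist ((∫ w, F w) ⟨z, hz⟩) (φ ⟨z, hz⟩) < Real.pi * ε :=
    (ContinuousMap.dist_apply_le_dist _).trans_lt hφd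
  rw [hval, hpφ, dist_eq_norm] at h1
  have hpi : (Real.pi : ℂ) ≠ 0 := by exact_mod_cast Real.pi_ne_zero
  have h2 : -(Real.pi : ℂ)⁻¹ * p z - g z = (Real.pi : ℂ)⁻¹ * (-(Real.pi : ℂ) * g z - p z) := by
    field_simp
    ring
  rw [h2, norm_mul, norm_inv, Complex.norm_real, Real.norm_eq_abs, abs_of_pos Real.pi_pos,
    inv_mul_lt_iff₀ Real.pi_pos]
  exact h1

/-! ### Separation of compact sets and gluing of approximations -/

/-- There are entire functions uniformly close to `0` on `K` and to `1` on `L`. -/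
def EntireSeparated (K L : Set ℂ) : Prop :=
  ∀ ε > 0, ∃ q : ℂ → ℂ, Differentiable ℂ q ∧ (∀ z ∈ K, ‖q z‖ < ε) ∧ ∀ z ∈ L, ‖q z - 1‖ < ε

theorem EntireSeparated.mono {K L K' L' : Set ℂ} (h : EntireSeparated K L) (hK : K' ⊆ K)
    (hL : L' ⊆ L) : EntireSeparated K' L' := fun ε hε =>
  let ⟨q, hq, h1, h2⟩ := h ε hε
  ⟨q, hq, fun _ hz => h1 _ (hK hz), fun _ hz => h2 _ (hL hz)⟩

theorem EntireSeparated.comp {K L K' L' : Set ℂ} (h : EntireSeparated K L) {e : ℂ → ℂ}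
    (he : Differentiable ℂ e) (hK : Set.MapsTo e K' K) (hL : Set.MapsTo e L' L) :
    EntireSeparated K' L' := fun ε hε =>
  let ⟨q, hq, h1, h2⟩ := h ε hε
  ⟨q ∘ e, hq.comp he, fun _ hz => h1 _ (hK hz), fun _ hz => h2 _ (hL hz)⟩

/-- The polynomial `3u² - 2u³` has superattracting fixed points at `0` and `1`. -/
noncomputable def smoothStep (u : ℂ) : ℂ := 3 * u ^ 2 - 2 * u ^ 3

theorem norm_smoothStep_le {u : ℂ} (hu : ‖u‖ ≤ 1 / 4) : ‖smoothStep u‖ ≤ 7 / 8 * ‖u‖ := by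
  have h1 : smoothStep u = u * (u * 3 - u ^ 2 * 2) := by unfold smoothStep; ring
  have h2 : ‖u * 3 - u ^ 2 * 2‖ ≤ 7 / 8 := by
    refine (norm_sub_le _ _).trans ?_
    simp only [norm_mul, norm_pow, Complex.norm_ofNat]
    nlinarith [norm_nonneg u]
  rw [h1, norm_mul, mul_comm]
  gcongr

theorem smoothStep_one_sub (u : ℂ) : smoothStep (1 - u) = 1 - smoothStep u := by
  unfold smoothStep; ring

theorem norm_iterate_smoothStep_le {u : ℂ} (hu : ‖u‖ ≤ 1 / 4) (n : ℕ) :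
    ‖smoothStep^[n] u‖ ≤ (7 / 8) ^ n * (1 / 4) := by
  induction n with
  | zero => simpa using hu
  | succ n ih =>
    rw [Function.iterate_succ_apply']
    have h1 : ((7 : ℝ) / 8) ^ n ≤ 1 := pow_le_one₀ (by norm_num) (by norm_num)
    refine (norm_smoothStep_le (by linarith)).trans ?_
    rw [pow_succ]
    linarith

theorem iterate_smoothStep_one_sub (u : ℂ) (n : ℕ) :
    smoothStep^[n] (1 - u) = 1 - smoothStep^[n] u := by
  induction n with
  | zero => rfl
  | succ n ih => rw [Function.iterate_succ_apply', ih, smoothStep_one_sub,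
      Function.iterate_succ_apply']

/-- Iterates of `smoothStep` contract the first disc to `0`, hence the second to `1` by the symmetry
`u ↦ 1 - u`. These explicit polynomials play the role of Runge's theorem on a disconnected set. -/
theorem entireSeparated_closedBall :
    EntireSeparated (Metric.closedBall 0 (1 / 4)) (Metric.closedBall 1 (1 / 4)) := by
  intro ε hε
  obtain ⟨n, hn⟩ := exists_pow_lt_of_lt_one hε (by norm_num : (7 / 8 : ℝ) < 1)
  have hs : Differentiable ℂ smoothStep := by unfold smoothStep; fun_prop
  have h0 : (0 : ℝ) ≤ (7 / 8) ^ n := by positivity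
  refine ⟨smoothStep^[n], hs.iterate n, fun z hz => ?_, fun z hz => ?_⟩
  · have := norm_iterate_smoothStep_le (by simpa using hz) n
    linarith
  · rw [mem_closedBall_iff_norm'] at hz
    have := norm_iterate_smoothStep_le hz n
    rw [iterate_smoothStep_one_sub] at this
    rw [norm_sub_rev]
    linarith

/-- Entire functions on separated compact sets can be simultaneously approximated. -/
theorem EntireSeparated.exists_approx {K L : Set ℂ} (h : EntireSeparated K L) (hK : IsCompact K)
    (hL : IsCompact L) {p q : ℂ → ℂ} (hp : Differentiable ℂ p) (hq : Differentiable ℂ q) {ε : ℝ}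
    (hε : 0 < ε) : ∃ r : ℂ → ℂ, Differentiable ℂ r ∧ (∀ z ∈ K, ‖r z - p z‖ < ε) ∧
      ∀ z ∈ L, ‖r z - q z‖ < ε := by
  obtain ⟨C, hC⟩ := (hK.union hL).exists_bound_of_continuousOn
    (hq.continuous.sub hp.continuous).continuousOn
  have hC' : 0 < |C| + 1 := by positivity
  have hbd : ∀ z ∈ K ∪ L, ∀ t : ℂ, ‖t‖ < ε / (|C| + 1) → ‖(q z - p z) * t‖ < ε := by
    intro z hz t ht
    rw [lt_div_iff₀ hC'] at ht
    rw [norm_mul]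
    have := hC z hz
    simp only [Pi.sub_apply] at this
    nlinarith [le_abs_self C, norm_nonneg t, norm_nonneg (q z - p z)]
  obtain ⟨s, hs, h0, h1⟩ := h (ε / (|C| + 1)) (by positivity)
  -- Interpolation: `s` is nearly `0` on `K` and nearly `1` on `L`, with an error scaled by a bound
  -- `C` for `q - p`.
  refine ⟨fun z => p z + (q z - p z) * s z, hp.add ((hq.sub hp).mul hs), fun z hz => ?_,
    fun z hz => ?_⟩
  · rw [add_sub_cancel_left]
    exact hbd z (Or.inl hz) _ (h0 z hz)
  · rw [show p z + (q z - p z) * s z - q z = (q z - p z) * (s z - 1) by ring]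
    exact hbd z (Or.inr hz) _ (h1 z hz)

/-- A point with an entire function peaking at it relative to `K` has a neighbourhood
separated from `K`. -/
theorem exists_entireSeparated_closedBall {K : Set ℂ} {c : ℂ} {e : ℂ → ℂ}
    (he : Differentiable ℂ e) (hK : ∀ z ∈ K, ‖e z‖ ≤ 1 / 4) (hc : e c = 1) :
    ∃ s₀ > 0, ∀ s ≤ s₀, EntireSeparated K (Metric.closedBall c s) := by
  have h1 : e ⁻¹' Metric.closedBall 1 (1 / 4) ∈ 𝓝 c :=
    he.continuous.continuousAt.preimage_mem_nhds
      (by rw [hc]; exact Metric.closedBall_mem_nhds _ (by norm_num))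
  obtain ⟨s₀, hs₀, hb⟩ := Metric.nhds_basis_closedBall.mem_iff.1 h1
  exact ⟨s₀, hs₀, fun s hs => entireSeparated_closedBall.comp he
    (fun z hz => by simpa using hK z hz)
    (fun z hz => hb (Metric.closedBall_subset_closedBall hs hz))⟩

/-- Existence of peaking functions from approximability of the Cauchy kernel. -/
theorem exists_entire_peak {K : Set ℂ} (hK : IsCompact K) {c : ℂ}
    (h : EntireApprox K fun z => (z - c)⁻¹) (hcK : c ∉ K) :
    ∃ e : ℂ → ℂ, Differentiable ℂ e ∧ (∀ z ∈ K, ‖e z‖ ≤ 1 / 4) ∧ e c = 1 := by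
  obtain ⟨C, hC⟩ := hK.exists_bound_of_continuousOn
    (f := fun z => z - c) (by fun_prop)
  obtain ⟨p, hp, hpK⟩ := h (1 / (4 * (|C| + 1))) (by positivity)
  -- As `p` is close to `1 / (z - c)` on `K`, this is small there, while it equals `1` at `c`.
  refine ⟨fun z => 1 - (z - c) * p z, by fun_prop, fun z hz => ?_, by simp⟩
  have hne : z - c ≠ 0 := by
    intro h0
    exact hcK (sub_eq_zero.1 h0 ▸ hz)
  have h1 : 1 - (z - c) * p z = -((z - c) * (p z - (z - c)⁻¹)) := by
    field_simp
    ring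
  change ‖1 - (z - c) * p z‖ ≤ 1 / 4
  rw [h1, norm_neg, norm_mul]
  have h2 := hC z hz
  have h3 := hpK z hz
  rw [lt_div_iff₀ (by positivity)] at h3
  nlinarith [le_abs_self C, norm_nonneg (z - c), norm_nonneg (p z - (z - c)⁻¹)]

theorem EntireApprox.congr {K : Set ℂ} {g g' : ℂ → ℂ} (h : EntireApprox K g)
    (hgg : Set.EqOn g g' K) : EntireApprox K g' := fun ε hε =>
  let ⟨p, hp, h1⟩ := h ε hε
  ⟨p, hp, fun z hz => hgg hz ▸ h1 z hz⟩

/-- Gluing lets Runge's theorem be applied to one piece at a time, so connectedness of the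
complement of a union never has to be proved. -/
theorem EntireApprox.union {K L : Set ℂ} {g : ℂ → ℂ} (hs : EntireSeparated K L)
    (hK : IsCompact K) (hL : IsCompact L) (h1 : EntireApprox K g) (h2 : EntireApprox L g) :
    EntireApprox (K ∪ L) g := by
  intro ε hε
  obtain ⟨p, hp, hpK⟩ := h1 (ε / 2) (half_pos hε)
  obtain ⟨q, hq, hqL⟩ := h2 (ε / 2) (half_pos hε)
  obtain ⟨r, hr, hrK, hrL⟩ := hs.exists_approx hK hL hp hq (half_pos hε)
  refine ⟨r, hr, ?_⟩
  rintro z (hz | hz)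
  · have := norm_sub_le_norm_sub_add_norm_sub (r z) (p z) (g z)
    linarith [hpK z hz, hrK z hz]
  · have := norm_sub_le_norm_sub_add_norm_sub (r z) (q z) (g z)
    linarith [hqL z hz, hrL z hz]

/-- For positive radius, the exterior of the disc is the image of a half-plane under `z ↦ c + exp
z`. -/
theorem isPreconnected_compl_closedBall (c : ℂ) (r : ℝ) :
    IsPreconnected (Metric.closedBall c r)ᶜ := by
  rcases lt_trichotomy r 0 with hr | rfl | hr
  · rw [Metric.closedBall_eq_empty.2 hr, Set.compl_empty]
    exact isPreconnected_univ
  · rw [Metric.closedBall_zero]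
    exact (isConnected_compl_singleton_of_one_lt_rank (by simp) c).isPreconnected
  · have : (Metric.closedBall c r)ᶜ = (fun z => c + Complex.exp z) '' {z | Real.log r < z.re} := by
      ext w
      simp only [Set.mem_compl_iff, Metric.mem_closedBall, not_le, Set.mem_image,
        Set.mem_ofPred_eq, dist_eq_norm]
      constructor
      · intro hw
        have hne : w - c ≠ 0 := by
          intro h
          rw [h, norm_zero] at hw
          linarith
        refine ⟨Complex.log (w - c), ?_, by rw [Complex.exp_log hne]; ring⟩
        rw [Complex.log_re]
        exact Real.log_lt_log hr hw
      · rintro ⟨z, hz, rfl⟩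
        rw [add_sub_cancel_left, Complex.norm_exp]
        exact (Real.log_lt_iff_lt_exp hr).1 hz
    rw [this]
    exact (convex_halfSpace_re_gt _).isPreconnected.image _ (by fun_prop)

theorem entireApprox_closedBall {c : ℂ} {r : ℝ} {U : Set ℂ} {g : ℂ → ℂ} (hU : IsOpen U)
    (hsub : Metric.closedBall c r ⊆ U) (hg : DifferentiableOn ℂ g U) :
    EntireApprox (Metric.closedBall c r) g :=
  entireApprox_of_differentiableOn (isCompact_closedBall c r)
    (isPreconnected_compl_closedBall c r) hU hsub hg

theorem entireApprox_inv_sub {K : Set ℂ} (hK : IsCompact K) (hconn : IsPreconnected Kᶜ) {c : ℂ}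
    (hc : c ∉ K) : EntireApprox K fun z => (z - c)⁻¹ := by
  refine entireApprox_of_differentiableOn hK hconn (isOpen_compl_singleton (x := c))
    (fun z hz h => hc (h ▸ hz)) fun z hz => ?_
  have hne : z - c ≠ 0 := sub_ne_zero.2 hz
  exact ((differentiableAt_id.sub_const c).inv hne).differentiableWithinAt

/-- Two discs which are small compared to the distance of their centres are separated. -/
theorem entireSeparated_closedBall_of_le {a b : ℂ} {r s : ℝ} (hab : a ≠ b)
    (hr : 4 * r ≤ ‖b - a‖) (hs : 4 * s ≤ ‖b - a‖) :
    EntireSeparated (Metric.closedBall a r) (Metric.closedBall b s) := by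
  have hne : b - a ≠ 0 := sub_ne_zero.2 hab.symm
  have hpos : 0 < ‖b - a‖ := norm_pos_iff.2 hne
  refine entireSeparated_closedBall.comp (e := fun z => (z - a) / (b - a)) (by fun_prop)
    (fun z hz => ?_) (fun z hz => ?_)
  · rw [mem_closedBall_iff_norm] at hz
    rw [mem_closedBall_zero_iff, norm_div, div_le_iff₀ hpos]
    linarith
  · rw [mem_closedBall_iff_norm] at hz ⊢
    have : (z - a) / (b - a) - 1 = (z - b) / (b - a) := by field_simp; ring
    rw [this, norm_div, div_le_iff₀ hpos]
    linarith

/-! ### Prescribed first-order data, stability of iterates, exit orbits and near-identity maps -/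

/-- Correction of an entire function preserving its value and derivative at a point. -/
theorem exists_entire_correction {K : Set ℂ} (hK : IsCompact K) {f Ψ : ℂ → ℂ} {z₀ : ℂ}
    (hf : Differentiable ℂ f) (hΨ : Ψ z₀ = f z₀)
    (h : EntireApprox K fun z => (Ψ z - f z) / (z - z₀) ^ 2) {δ : ℝ} (hδ : 0 < δ) :
    ∃ F : ℂ → ℂ, Differentiable ℂ F ∧ F z₀ = f z₀ ∧ deriv F z₀ = deriv f z₀ ∧
      ∀ z ∈ K, ‖F z - Ψ z‖ < δ := by
  obtain ⟨C, hC⟩ := hK.exists_bound_of_continuousOn (f := fun z => (z - z₀) ^ 2) (by fun_prop)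
  obtain ⟨p, hp, hpK⟩ := h (δ / (|C| + 1)) (by positivity)
  -- The double zero of the correction preserves value and derivative at `z₀`.
  refine ⟨fun z => f z + (z - z₀) ^ 2 * p z, by fun_prop, by simp, ?_, fun z hz => ?_⟩
  · have h1 : HasDerivAt (fun z => (z - z₀) ^ 2 * p z)
        ((2 : ℕ) * (z₀ - z₀) ^ 1 * 1 * p z₀ + (z₀ - z₀) ^ 2 * deriv p z₀) z₀ :=
      (((hasDerivAt_id z₀).sub_const z₀).pow 2).mul (hp z₀).hasDerivAt
    exact ((hf z₀).hasDerivAt.add h1).deriv.trans (by simp)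
  · rcases eq_or_ne z z₀ with rfl | hne
    · simp [hΨ, hδ]
    · have hne' : z - z₀ ≠ 0 := sub_ne_zero.2 hne
      have h1 : f z + (z - z₀) ^ 2 * p z - Ψ z =
          (z - z₀) ^ 2 * (p z - (Ψ z - f z) / (z - z₀) ^ 2) := by
        field_simp
        ring
      change ‖f z + (z - z₀) ^ 2 * p z - Ψ z‖ < δ
      rw [h1, norm_mul]
      have h2 := hC z hz
      have h3 := hpK z hz
      rw [lt_div_iff₀ (by positivity)] at h3
      nlinarith [le_abs_self C, norm_nonneg ((z - z₀) ^ 2),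
        norm_nonneg (p z - (Ψ z - f z) / (z - z₀) ^ 2)]

/-- If iterates of a continuous model map keep a compact set inside an open set, then
maps uniformly close to the model on that open set have nearby iterates. -/
theorem exists_iterate_close {Ψ : ℂ → ℂ} {V K : Set ℂ} (hV : IsOpen V)
    (hΨ : ContinuousOn Ψ V) (hK : IsCompact K) (n : ℕ)
    (hmaps : ∀ j < n, ∀ z ∈ K, Ψ^[j] z ∈ V) {ε : ℝ} (hε : 0 < ε) :
    ∃ δ > 0, ∀ F : ℂ → ℂ, (∀ z ∈ V, ‖F z - Ψ z‖ ≤ δ) →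
      ∀ j ≤ n, ∀ z ∈ K, ‖F^[j] z - Ψ^[j] z‖ ≤ ε := by
  have hcont : ∀ j ≤ n, ContinuousOn Ψ^[j] K := by
    intro j hj
    induction j with
    | zero => exact continuousOn_id
    | succ j ih =>
      rw [Function.iterate_succ']
      exact hΨ.comp (ih (by omega)) fun z hz => hmaps j hj z hz
  induction n generalizing ε with
  | zero =>
    refine ⟨1, one_pos, fun F _ j hj z _ => ?_⟩
    obtain rfl : j = 0 := by omega
    simpa using hε.le
  | succ n ih =>
    have hL : IsCompact (Ψ^[n] '' K) := hK.image_of_continuousOn (hcont n (by omega))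
    have hLV : Ψ^[n] '' K ⊆ V := by
      rintro _ ⟨z, hz, rfl⟩
      exact hmaps n (by omega) z hz
    -- The points `F^[n] z` need not lie in `Ψ^[n] '' K`, so uniform continuity of `Ψ` is used on a
    -- compact thickening inside `V`.
    obtain ⟨ρ, hρ, hρV⟩ := hL.exists_cthickening_subset_open hV hLV
    have huc := (hL.cthickening (r := ρ)).uniformContinuousOn_of_continuous (hΨ.mono hρV)
    obtain ⟨η, hη, hη'⟩ := Metric.uniformContinuousOn_iff.1 huc (ε / 2) (half_pos hε)
    obtain ⟨δ, hδ, hδ'⟩ := ih (fun j hj => hmaps j (by omega))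
      (ε := min ε (min ρ (η / 2))) (by positivity) (fun j hj => hcont j (by omega))
    refine ⟨min δ (ε / 2), by positivity, fun F hF j hj z hz => ?_⟩
    have hclose := hδ' F fun w hw => (hF w hw).trans (min_le_left _ _)
    rcases Nat.lt_or_eq_of_le hj with hj | rfl
    · exact (hclose j (by omega) z hz).trans (min_le_left _ _)
    · have h1 := hclose n le_rfl z hz
      have hmem : Ψ^[n] z ∈ Metric.cthickening ρ (Ψ^[n] '' K) :=
        Metric.self_subset_cthickening _ ⟨z, hz, rfl⟩
      have hmem' : F^[n] z ∈ Metric.cthickening ρ (Ψ^[n] '' K) := by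
        refine Metric.mem_cthickening_of_dist_le _ _ _ _ ⟨z, hz, rfl⟩ ?_
        rw [dist_eq_norm]
        exact h1.trans ((min_le_right _ _).trans (min_le_left _ _))
      have h2 := hη' _ hmem' _ hmem (by
        rw [dist_eq_norm]
        have := h1.trans ((min_le_right _ _).trans (min_le_right _ _))
        linarith)
      rw [dist_eq_norm] at h2
      have h3 := (hF _ (hρV hmem')).trans (min_le_right _ _)
      rw [Function.iterate_succ_apply', Function.iterate_succ_apply']
      have := norm_sub_le_norm_sub_add_norm_sub (F (F^[n] z)) (Ψ (F^[n] z)) (Ψ (Ψ^[n] z))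
      linarith

/-- Near a repelling fixed point of multiplier `2` there are points whose orbits leave a given
disc, landing at the exit time outside a prescribed closed set, along a noncritical orbit. -/
theorem exists_exit_orbit {f : ℂ → ℂ} (hf : Differentiable ℂ f) {z₀ : ℂ} (hz₀ : f z₀ = z₀)
    (hd : deriv f z₀ = 2) {R : ℝ} (hR : 0 < R) {D : Set ℂ} (hD : IsClosed D)
    (hdisj : Disjoint (Metric.closedBall z₀ R) D) {δ : ℝ} (hδ : 0 < δ) :
    ∃ b : ℂ, ∃ m : ℕ, ‖b - z₀‖ < δ ∧ (∀ j < m, f^[j] b ∈ Metric.ball z₀ R) ∧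
      f^[m] b ∉ Metric.closedBall z₀ R ∪ D ∧ deriv f^[m] b ≠ 0 := by
  wlog hδR : δ ≤ R generalizing δ
  · obtain ⟨b, m, hb, h⟩ := this hR le_rfl
    exact ⟨b, m, hb.trans (not_le.1 hδR), h⟩
  have hder : ∀ m, HasDerivAt f^[m] (2 ^ m) z₀ :=
    fun m =>
    HasDerivAt.iterate (f := f) (x := z₀) (f' := 2) (hd ▸ (hf z₀).hasDerivAt) hz₀ m
  have hfix : ∀ m, f^[m] z₀ = z₀ := fun m => Function.iterate_fixed hz₀ m
  -- If all iterates kept the ball within radius `R`, Cauchy's estimate would bound the derivatives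
  -- `2 ^ m` at `z₀`.
  have hex : ∃ m, ¬ Set.MapsTo f^[m] (Metric.ball z₀ δ) (Metric.closedBall z₀ R) := by
    by_contra! hall
    obtain ⟨m, hm⟩ := pow_unbounded_of_one_lt (R / (δ / 2)) (one_lt_two (α := ℝ))
    have h1 := Complex.norm_deriv_le_of_forall_mem_sphere_norm_le (c := z₀) (R := δ / 2) (C := R)
      (f := fun z => f^[m] z - z₀) (half_pos hδ)
      ((hf.iterate m).sub_const z₀).diffContOnCl (fun z hz => by
        rw [← dist_eq_norm]
        refine hall m ?_
        rw [mem_sphere_iff_norm] at hz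
        rw [mem_ball_iff_norm, hz]
        linarith)
    rw [((hder m).sub_const z₀).deriv, norm_pow, Complex.norm_ofNat] at h1
    linarith
  classical
  have hspec := Nat.find_spec hex
  have hmin := fun j hj => not_not.1 (Nat.find_min hex (m := j) hj)
  set m := Nat.find hex
  set V := Metric.ball z₀ δ ∩ f^[m] ⁻¹' (Metric.closedBall z₀ R ∪ D)ᶜ with hV
  have hVo : IsOpen V := Metric.isOpen_ball.inter
    ((Metric.isClosed_closedBall.union hD).isOpen_compl.preimage (hf.continuous.iterate m))
  -- The image of the ball is connected and contains `z₀`; if covered by the disjoint closed sets,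
  -- it would lie in the disc, contrary to the choice of `m`.
  have hVne : V.Nonempty := by
    by_contra hemp
    rw [Set.not_nonempty_iff_eq_empty, hV, ← Set.disjoint_iff_inter_eq_empty] at hemp
    have hsub : f^[m] '' Metric.ball z₀ δ ⊆ Metric.closedBall z₀ R ∪ D := by
      rintro _ ⟨z, hz, rfl⟩
      by_contra h
      exact Set.disjoint_left.1 hemp hz h
    have hpre : IsPreconnected (f^[m] '' Metric.ball z₀ δ) :=
      (convex_ball z₀ δ).isPreconnected.image _ (hf.continuous.iterate m).continuousOn
    have hzm : z₀ ∈ f^[m] '' Metric.ball z₀ δ := ⟨z₀, Metric.mem_ball_self hδ, hfix m⟩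
    rcases isPreconnected_iff_subset_of_disjoint_closed.1 hpre _ _ Metric.isClosed_closedBall hD
      hsub (by rw [hdisj.inter_eq, Set.inter_empty]) with h | h
    · exact hspec fun z hz => h ⟨z, hz, rfl⟩
    · exact Set.disjoint_left.1 hdisj (Metric.mem_closedBall_self hR.le) (h hzm)
  -- By the identity theorem `deriv f^[m]` cannot vanish on all of `V`, being `2 ^ m` at `z₀`.
  obtain ⟨b, hb, hbd⟩ : ∃ b ∈ V, deriv f^[m] b ≠ 0 := by
    by_contra! hall
    obtain ⟨b, hb⟩ := hVne
    have han : AnalyticOnNhd ℂ (deriv f^[m]) Set.univ := fun z _ =>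
      (((hf.iterate m).analyticAt z).deriv)
    have h1 := han.eq_of_eventuallyEq (g := fun _ => 0) (fun z _ => analyticAt_const) (z₀ := b)
      (Filter.eventually_of_mem (hVo.mem_nhds hb) hall)
    have h2 := congrFun h1 z₀
    rw [(hder m).deriv] at h2
    exact pow_ne_zero m two_ne_zero h2
  refine ⟨b, m, mem_ball_iff_norm.1 hb.1, fun j hj => ?_, hb.2, hbd⟩
  have hj' := hmin j hj
  rw [mem_ball_iff_norm]
  refine lt_of_le_of_ne (mem_closedBall_iff_norm.1 (hj' hb.1)) fun heq => ?_
  -- Before time `m` the orbit lies in the open disc: reaching its boundary would violate the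
  -- maximum principle, as the function vanishes at `z₀`.
  have h1 := Complex.norm_eqOn_of_isPreconnected_of_isMaxOn (f := fun z => f^[j] z - z₀)
    (convex_ball z₀ δ).isPreconnected Metric.isOpen_ball
    ((hf.iterate j).sub_const z₀).differentiableOn hb.1 (fun z hz => by
      simp only [Function.comp, Set.mem_ofPred_eq, heq]
      exact mem_closedBall_iff_norm.1 (hj' hz))
  have h2 := h1 (Metric.mem_ball_self hδ)
  simp only [Function.comp, hfix, sub_self, norm_zero, heq, Function.const] at h2
  exact hR.ne h2

/-- A holomorphic function close to the identity near `X` differs from the identity by a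
contraction. -/
theorem approximatesLinearOn_of_norm_sub_le {X : Set ℂ} {ρ : ℝ} (hρ : 0 < ρ) {g : ℂ → ℂ}
    (hg : Differentiable ℂ g) (hclose : ∀ z ∈ Metric.cthickening ρ X, ‖g z - z‖ ≤ ρ / 16) :
    ApproximatesLinearOn g ((ContinuousLinearEquiv.refl ℂ ℂ : ℂ ≃L[ℂ] ℂ) : ℂ →L[ℂ] ℂ)
      (Metric.thickening (ρ / 2) X) (1 / 2) := by
  have hthick : ∀ x ∈ Metric.thickening (ρ / 2) X, ∀ y, ‖y - x‖ ≤ ρ / 2 →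
      ‖g y - y‖ ≤ ρ / 16 := by
    intro x hx y hy
    obtain ⟨w, hw, hxw⟩ := Metric.mem_thickening_iff.1 hx
    refine hclose y (Metric.mem_cthickening_of_dist_le y w _ _ hw ?_)
    rw [← dist_eq_norm] at hy
    linarith [dist_triangle y x w]
  intro x hx y hy
  have hcoe : ((ContinuousLinearEquiv.refl ℂ ℂ : ℂ ≃L[ℂ] ℂ) : ℂ →L[ℂ] ℂ) (x - y) = x - y := rfl
  rw [hcoe]
  have hre : g x - g y - (x - y) = (g x - x) - (g y - y) := by ring
  push_cast
  rw [hre]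
  -- For close points, Cauchy's estimate on radius `ρ / 4` bounds the derivative of `g - id` by `1 /
  -- 4`. For distant ones, the two errors add up to `ρ / 8`, at most half of `‖x - y‖`.
  by_cases hxy : ‖x - y‖ < ρ / 4
  · have hbound : ∀ z ∈ Metric.ball y (ρ / 4), ‖deriv (fun z => g z - z) z‖ ≤ 1 / 4 := by
      intro z hz
      rw [mem_ball_iff_norm] at hz
      have := Complex.norm_deriv_le_of_forall_mem_sphere_norm_le (c := z) (R := ρ / 4)
        (C := ρ / 16) (f := fun z => g z - z) (by positivity)
        (hg.sub differentiable_id).diffContOnCl (fun w hw => by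
          rw [mem_sphere_iff_norm] at hw
          refine hthick y hy w ?_
          linarith [norm_sub_le_norm_sub_add_norm_sub w z y])
      refine this.trans (le_of_eq ?_)
      field_simp
      norm_num
    have := (convex_ball y (ρ / 4)).norm_image_sub_le_of_norm_deriv_le
      (f := fun z => g z - z) (fun z _ => (hg.sub differentiable_id) z) hbound
      (Metric.mem_ball_self (by positivity)) (mem_ball_iff_norm.2 hxy)
    linarith [norm_nonneg (x - y)]
  · have h1 := hthick x hx x (by simp; positivity)
    have h2 := hthick y hy y (by simp; positivity)
    have := norm_sub_le (g x - x) (g y - y)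
    linarith

theorem injOn_of_norm_sub_le {X : Set ℂ} {ρ : ℝ} (hρ : 0 < ρ) {g : ℂ → ℂ}
    (hg : Differentiable ℂ g) (hclose : ∀ z ∈ Metric.cthickening ρ X, ‖g z - z‖ ≤ ρ / 16) :
    Set.InjOn g X := by
  have h := approximatesLinearOn_of_norm_sub_le hρ hg hclose
  refine (h.injOn (Or.inr ?_)).mono (Metric.self_subset_thickening (by positivity) X)
  have : ‖((ContinuousLinearEquiv.refl ℂ ℂ).symm : ℂ →L[ℂ] ℂ)‖₊ = 1 := by
    simp
  rw [this, inv_one]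
  exact half_lt_self one_pos

/-- A holomorphic function close to the identity near `X` has a holomorphic inverse near `X`. -/
theorem exists_inverse_of_norm_sub_le {X : Set ℂ} {ρ : ℝ} (hρ : 0 < ρ) {g : ℂ → ℂ}
    (hg : Differentiable ℂ g) (hclose : ∀ z ∈ Metric.cthickening ρ X, ‖g z - z‖ ≤ ρ / 16) :
    ∃ (W : Set ℂ) (ψ : ℂ → ℂ), IsOpen W ∧ X ⊆ W ∧ DifferentiableOn ℂ ψ W ∧
      ∀ z ∈ X, ψ (g z) = z := by
  have h := approximatesLinearOn_of_norm_sub_le hρ hg hclose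
  have hN : ‖((ContinuousLinearEquiv.refl ℂ ℂ).symm : ℂ →L[ℂ] ℂ)‖₊ = 1 := by
    simp
  have hc : Subsingleton ℂ ∨
      (1 / 2 : NNReal) < ‖((ContinuousLinearEquiv.refl ℂ ℂ).symm : ℂ →L[ℂ] ℂ)‖₊⁻¹ := by
    right
    rw [hN, inv_one]
    exact half_lt_self one_pos
  let e := h.toOpenPartialHomeomorph g _ hc Metric.isOpen_thickening
  have hXN : X ⊆ Metric.thickening (ρ / 2) X := Metric.self_subset_thickening (by positivity) X
  refine ⟨e.target, e.symm, e.open_target, fun w hw => ?_, fun w hw => ?_, fun z hz => ?_⟩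
  -- The image of this ball contains the ball about `g w` of radius `(1 - 1 / 2) * (ρ / 4) = ρ / 8`,
  -- and `w` is within `ρ / 16` of `g w`.
  · have hsub : Metric.closedBall w (ρ / 4) ⊆ Metric.thickening (ρ / 2) X := by
      intro y hy
      rw [Metric.mem_closedBall] at hy
      exact Metric.mem_thickening_iff.2 ⟨w, hw, by linarith⟩
    have hsurj := h.surjOn_closedBall_of_nonlinearRightInverse
      (ContinuousLinearEquiv.toNonlinearRightInverse (ContinuousLinearEquiv.refl ℂ ℂ))
      (by positivity : (0 : ℝ) ≤ ρ / 4) hsub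
    have hmem : w ∈ Metric.closedBall (g w)
        ((((ContinuousLinearEquiv.toNonlinearRightInverse
          (ContinuousLinearEquiv.refl ℂ ℂ)).nnnorm : ℝ)⁻¹ - (1 / 2 : NNReal)) * (ρ / 4)) := by
      have h1 : (ContinuousLinearEquiv.toNonlinearRightInverse
          (ContinuousLinearEquiv.refl ℂ ℂ)).nnnorm = 1 := hN
      rw [h1, mem_closedBall_iff_norm']
      have := hclose w (Metric.self_subset_cthickening X hw)
      push_cast
      linarith
    obtain ⟨y, hy, hyw⟩ := hsurj hmem
    exact ⟨y, hsub hy, hyw⟩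
  · have hs : e.symm w ∈ Metric.thickening (ρ / 2) X := e.map_target hw
    -- A zero derivative would make `g` contract by `1 / 4` near the point, which is incompatible
    -- with differing from the identity by a `1 / 2`-contraction.
    have hder : deriv g (e.symm w) ≠ 0 := by
      intro h0
      have hd : HasDerivAt g 0 (e.symm w) := h0 ▸ (hg _).hasDerivAt
      have h1 := (hasDerivAt_iff_isLittleO.1 hd).def (c := 1 / 4) (by norm_num)
      have h2 := (h1.and (Metric.isOpen_thickening.mem_nhds hs))
      obtain ⟨y, hy, hne⟩ :=
        ((h2.filter_mono nhdsWithin_le_nhds).and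
          (self_mem_nhdsWithin (a := e.symm w) (s := {e.symm w}ᶜ))).exists
      have h3 := h y hy.2 _ hs
      have h4 := hy.1
      have hcoe : ((ContinuousLinearEquiv.refl ℂ ℂ : ℂ ≃L[ℂ] ℂ) : ℂ →L[ℂ] ℂ) (y - e.symm w) =
        y - e.symm w := rfl
      rw [hcoe] at h3
      push_cast at h3
      simp only [smul_zero, sub_zero] at h4
      have h5 : 0 < ‖y - e.symm w‖ := norm_pos_iff.2 (sub_ne_zero.2 hne)
      have h6 := norm_sub_norm_le (y - e.symm w) (g y - g (e.symm w))
      rw [norm_sub_rev (y - e.symm w) (g y - g (e.symm w))] at h6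
      linarith
    exact (e.hasDerivAt_symm hw hder (hg _).hasDerivAt).differentiableAt.differentiableWithinAt
  · exact e.left_inv (hXN hz)

/-! ### Nested compact neighbourhoods with connected complement -/

/-- A compact plane set with connected complement has arbitrarily small compact neighbourhoods
with connected complement. -/
theorem exists_compact_nhds_isPreconnected_compl {K W : Set ℂ} (hK : IsCompact K)
    (hconn : IsConnected Kᶜ) (hW : IsOpen W) (hKW : K ⊆ W) :
    ∃ T, IsCompact T ∧ K ⊆ interior T ∧ T ⊆ W ∧ IsPreconnected Tᶜ := by
  obtain ⟨M, hM0, hM⟩ := hK.isBounded.exists_pos_norm_lt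
  let δ : ℕ → ℝ := fun n => 1 / ((n : ℝ) + 1)
  have hδ : ∀ n, 0 < δ n := fun n => Nat.one_div_pos_of_nat
  have hδ1 : ∀ n, δ n ≤ 1 := fun n => by
    have h1 : (1 : ℝ) ≤ n + 1 := by simp
    exact div_le_one_of_le₀ h1 (by positivity)
  let U : ℕ → Set ℂ := fun n => (Metric.cthickening (δ n) K)ᶜ
  have hUo : ∀ n, IsOpen (U n) := fun n => Metric.isClosed_cthickening.isOpen_compl
  have hext : ∀ n, (Metric.closedBall (0 : ℂ) (M + 1))ᶜ ⊆ U n := by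
    intro n z hz hzK
    apply hz
    rw [hK.cthickening_eq_biUnion_closedBall (hδ n).le] at hzK
    simp only [Set.mem_iUnion, exists_prop] at hzK
    obtain ⟨w, hw, hzw⟩ := hzK
    rw [mem_closedBall_iff_norm] at hzw
    rw [mem_closedBall_zero_iff]
    have := norm_sub_norm_le z w
    linarith [hM w hw, hδ1 n]
  set p : ℂ := ((M + 2 : ℝ) : ℂ) with hp
  have hpext : p ∈ (Metric.closedBall (0 : ℂ) (M + 1))ᶜ := by
    rw [Set.mem_compl_iff, mem_closedBall_zero_iff, hp, Complex.norm_real, Real.norm_eq_abs,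
      abs_of_pos (by linarith)]
    linarith
  let O : ℕ → Set ℂ := fun n => connectedComponentIn (U n) p
  have hOo : ∀ n, IsOpen (O n) := fun n => (hUo n).connectedComponentIn
  have hOU : ∀ n, O n ⊆ U n := fun n => connectedComponentIn_subset _ _
  have hextO : ∀ n, (Metric.closedBall (0 : ℂ) (M + 1))ᶜ ⊆ O n := fun n =>
    (isPreconnected_compl_closedBall 0 (M + 1)).subset_connectedComponentIn hpext (hext n)
  have hmono : Monotone O := by
    intro m n hmn
    refine connectedComponentIn_mono p (Set.compl_subset_compl.2 (Metric.cthickening_mono ?_ K))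
    exact Nat.one_div_le_one_div hmn
  -- A path in the complement from `p` to `w` stays at positive distance from `K`, hence lies in one
  -- component `O n`. Compactness then yields a single `n`, and the neighbourhood is the complement
  -- of `O n`.
  have hcover : Kᶜ ⊆ ⋃ n, O n := by
    intro w hw
    have hpK : p ∈ Kᶜ := fun h => hext 0 hpext (Metric.self_subset_cthickening K h)
    obtain ⟨γ, hγ⟩ := (hK.isClosed.isOpen_compl.isConnected_iff_isPathConnected.1
      hconn).joinedIn p hpK w hw
    have hrange : IsCompact (Set.range γ) := isCompact_range γ.continuous
    obtain ⟨r, hr, hrK⟩ := hK.exists_cthickening_subset_open hrange.isClosed.isOpen_compl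
      (fun z hz => by
        rintro ⟨t, rfl⟩
        exact hγ t hz)
    obtain ⟨n, hn⟩ := exists_nat_one_div_lt hr
    have hsub : Set.range γ ⊆ U n := fun z hz hzK =>
      hrK (Metric.cthickening_mono hn.le K hzK) hz
    have hpre : IsPreconnected (Set.range γ) := isPreconnected_range γ.continuous
    refine Set.mem_iUnion.2 ⟨n, hpre.subset_connectedComponentIn ⟨0, γ.source⟩ hsub
      ⟨1, γ.target⟩⟩
  obtain ⟨n, hn⟩ := ((isCompact_closedBall (0 : ℂ) (M + 1)).diff hW).elim_directed_cover O hOo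
    (fun z hz => hcover fun h => hz.2 (hKW h)) hmono.directed_le
  refine ⟨(O n)ᶜ, ?_, ?_, ?_, ?_⟩
  · exact (isCompact_closedBall (0 : ℂ) (M + 1)).of_isClosed_subset (hOo n).isClosed_compl
      (Set.compl_subset_comm.1 (hextO n))
  · refine (Metric.self_subset_thickening (hδ n) K).trans
      (interior_maximal ?_ Metric.isOpen_thickening)
    exact (Metric.thickening_subset_cthickening _ _).trans (Set.subset_compl_comm.1 (hOU n))
  · intro z hz
    by_contra hzW
    by_cases hzM : z ∈ Metric.closedBall (0 : ℂ) (M + 1)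
    · exact hz (hn ⟨hzM, hzW⟩)
    · exact hz (hextO n hzM)
  · rw [compl_compl]
    exact isPreconnected_connectedComponentIn

/-- One step of a nested sequence of neighbourhoods peeling off points near the boundary. -/
theorem exists_nested_step {K T : Set ℂ} (hK : IsCompact K) (hconn : IsConnected Kᶜ)
    (hKT : K ⊆ interior T) {x : ℂ} (hxK : x ∈ K) (hx : x ∈ closure Kᶜ)
    {ε : ℝ} (hε : 0 < ε) :
    ∃ T' S : Set ℂ, ∃ a : ℂ, ∃ ρ : ℝ, (IsCompact T' ∧ K ⊆ interior T') ∧ 0 < ρ ∧ ρ ≤ 1 ∧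
      IsCompact S ∧ IsPreconnected Sᶜ ∧ K ⊆ S ∧ Metric.cthickening ρ S ⊆ T ∧
      Metric.cthickening ρ T' ⊆ S ∧ a ∈ T ∧ a ∉ Metric.cthickening ρ S ∧ dist a x < ε := by
  obtain ⟨a, ⟨haT, hax⟩, haK⟩ := mem_closure_iff.1 hx (interior T ∩ Metric.ball x ε)
    (isOpen_interior.inter Metric.isOpen_ball) ⟨hKT hxK, Metric.mem_ball_self hε⟩
  -- Deleting `a` from the allowed region forces the next neighbourhood `S`, and a thickening of it,
  -- to avoid `a`.
  have hWo : IsOpen (interior T \ {a}) := isOpen_interior.sdiff isClosed_singleton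
  obtain ⟨S, hS, hKS, hSW, hSc⟩ := exists_compact_nhds_isPreconnected_compl hK hconn
    hWo (fun z hz => ⟨hKT hz, fun h => haK (h ▸ hz)⟩)
  obtain ⟨r, hr, hrW⟩ := hS.exists_cthickening_subset_open hWo hSW
  obtain ⟨T', hT', hKT', hT'S⟩ := exists_compact_between hK isOpen_interior hKS
  obtain ⟨s, hs, hsS⟩ := hT'.exists_cthickening_subset_open isOpen_interior hT'S
  have h1 : Metric.cthickening (min 1 (min r s)) S ⊆ interior T \ {a} :=
    (Metric.cthickening_mono ((min_le_right _ _).trans (min_le_left _ _)) S).trans hrW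
  refine ⟨T', S, a, min 1 (min r s), ⟨hT', hKT'⟩, by positivity, min_le_left _ _, hS, hSc,
    hKS.trans interior_subset, h1.trans (Set.sdiff_subset.trans interior_subset), ?_,
    interior_subset haT, fun h => (h1 h).2 rfl, hax⟩
  exact ((Metric.cthickening_mono ((min_le_right _ _).trans (min_le_right _ _)) T').trans
    hsS).trans interior_subset

/-- A nested sequence of compact neighbourhoods of `K`, peeling off points `a k` of the complement
near prescribed boundary points. -/
structure NestedNhds (K : Set ℂ) (x : ℕ → ℂ) where
  T : ℕ → Set ℂ
  S : ℕ → Set ℂ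
  a : ℕ → ℂ
  ρ : ℕ → ℝ
  isCompact_T : ∀ k, IsCompact (T k)
  isCompact_S : ∀ k, IsCompact (S k)
  subset_T : ∀ k, K ⊆ T k
  subset_S : ∀ k, K ⊆ S k
  ρ_pos : ∀ k, 0 < ρ k
  ρ_le : ∀ k, ρ k ≤ 1
  compl_S : ∀ k, IsPreconnected (S k)ᶜ
  S_subset : ∀ k, Metric.cthickening (ρ k) (S k) ⊆ T k
  T_subset : ∀ k, Metric.cthickening (ρ k) (T (k + 1)) ⊆ S k
  a_mem : ∀ k, a k ∈ T k
  a_notMem : ∀ k, a k ∉ Metric.cthickening (ρ k) (S k)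
  dist_a : ∀ k, dist (a k) (x k) < 1 / ((k : ℝ) + 1)

theorem exists_nestedNhds {K : Set ℂ} (hK : IsCompact K) (hconn : IsConnected Kᶜ) {x : ℕ → ℂ}
    (hxK : ∀ k, x k ∈ K) (hx : ∀ k, x k ∈ closure Kᶜ) : Nonempty (NestedNhds K x) := by
  obtain ⟨T₀, hT₀, hKT₀, -⟩ := exists_compact_between hK isOpen_univ (Set.subset_univ K)
  have step : ∀ (k : ℕ) (T : {T : Set ℂ // IsCompact T ∧ K ⊆ interior T}),
      ∃ T' : {T : Set ℂ // IsCompact T ∧ K ⊆ interior T}, ∃ (S : Set ℂ) (a : ℂ) (ρ : ℝ),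
        0 < ρ ∧ ρ ≤ 1 ∧ IsCompact S ∧ IsPreconnected Sᶜ ∧ K ⊆ S ∧
        Metric.cthickening ρ S ⊆ T.1 ∧ Metric.cthickening ρ T'.1 ⊆ S ∧ a ∈ T.1 ∧
        a ∉ Metric.cthickening ρ S ∧ dist a (x k) < 1 / ((k : ℝ) + 1) := by
    intro k T
    obtain ⟨T', S, a, ρ, hT', h⟩ := exists_nested_step hK hconn T.2.2 (hxK k) (hx k)
      (Nat.one_div_pos_of_nat (n := k) (α := ℝ))
    exact ⟨⟨T', hT'⟩, S, a, ρ, h⟩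
  choose next S a ρ h using step
  let T : ℕ → {T : Set ℂ // IsCompact T ∧ K ⊆ interior T} :=
    fun k => Nat.rec ⟨T₀, hT₀, hKT₀⟩ (fun k T => next k T) k
  have hT : ∀ k, T (k + 1) = next k (T k) := fun k => rfl
  exact ⟨{
    T := fun k => (T k).1
    S := fun k => S k (T k)
    a := fun k => a k (T k)
    ρ := fun k => ρ k (T k)
    isCompact_T := fun k => (T k).2.1
    isCompact_S := fun k => (h k (T k)).2.2.1
    subset_T := fun k => (T k).2.2.trans interior_subset
    subset_S := fun k => (h k (T k)).2.2.2.2.1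
    ρ_pos := fun k => (h k (T k)).1
    ρ_le := fun k => (h k (T k)).2.1
    compl_S := fun k => (h k (T k)).2.2.2.1
    S_subset := fun k => (h k (T k)).2.2.2.2.2.1
    T_subset := fun k => by
      rw [hT]
      exact (h k (T k)).2.2.2.2.2.2.1
    a_mem := fun k => (h k (T k)).2.2.2.2.2.2.2.1
    a_notMem := fun k => (h k (T k)).2.2.2.2.2.2.2.2.1
    dist_a := fun k => (h k (T k)).2.2.2.2.2.2.2.2.2 }⟩

/-! ### Stages of the construction and the inductive step -/

theorem iterate_eq_of_eqOn {X : Type*} {f g : X → X} {D : Set X} (h : Set.EqOn g f D) {z : X}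
    {n : ℕ} (hz : ∀ j < n, f^[j] z ∈ D) : ∀ j ≤ n, g^[j] z = f^[j] z := by
  intro j hj
  induction j with
  | zero => rfl
  | succ j ih =>
    rw [Function.iterate_succ_apply', Function.iterate_succ_apply', ih (by omega),
      h (hz j (by omega))]

/-- Small affine copies of a disc near a noncritical orbit are mapped almost affinely. -/
theorem exists_scale {f : ℂ → ℂ} (hf : Differentiable ℂ f) {b : ℂ} {m : ℕ}
    (hd : deriv f^[m] b ≠ 0) {D : Set ℂ} (hD : IsOpen D) (hb : ∀ j < m, f^[j] b ∈ D)
    {M τ η : ℝ} (hM : 0 < M) (hτ : 0 < τ) (hη : 0 < η) :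
    ∃ σ : ℂ, σ ≠ 0 ∧ ∀ z : ℂ, ‖z‖ ≤ M → (∀ j < m, f^[j] (σ * z + b) ∈ D) ∧
      (∀ j ≤ m, ‖f^[j] (σ * z + b) - f^[j] b‖ ≤ τ) ∧
      ‖f^[m] (σ * z + b) - f^[m] b - σ * deriv f^[m] b * z‖ ≤ ‖σ * deriv f^[m] b‖ * η := by
  have hcont : ∀ j, ContinuousAt f^[j] b := fun j => (hf.continuous.iterate j).continuousAt
  have h1 : ∀ᶠ u in 𝓝 b, ∀ j ∈ Set.Iio m, f^[j] u ∈ D :=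
    (eventually_all_finite (Set.finite_Iio m)).2 fun j hj =>
      (hcont j).eventually (hD.mem_nhds (hb j hj))
  have h2 : ∀ᶠ u in 𝓝 b, ∀ j ∈ Set.Iic m, ‖f^[j] u - f^[j] b‖ ≤ τ :=
    (eventually_all_finite (Set.finite_Iic m)).2 fun j _ => by
      filter_upwards [(hcont j).eventually (Metric.closedBall_mem_nhds _ hτ)] with u hu
      exact mem_closedBall_iff_norm.1 hu
  have hpos : 0 < ‖deriv f^[m] b‖ := norm_pos_iff.2 hd
  have h3 := (hasDerivAt_iff_isLittleO.1 ((hf.iterate m) b).hasDerivAt).def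
    (c := ‖deriv f^[m] b‖ * η / M) (by positivity)
  obtain ⟨r, hr, hr'⟩ := Metric.nhds_basis_closedBall.eventually_iff.1 (h1.and (h2.and h3))
  have hσ : ‖((r / M : ℝ) : ℂ)‖ = r / M := by
    rw [Complex.norm_real, Real.norm_eq_abs, abs_of_pos (by positivity)]
  refine ⟨((r / M : ℝ) : ℂ), by exact_mod_cast (div_pos hr hM).ne', fun z hz => ?_⟩
  have hmem : ((r / M : ℝ) : ℂ) * z + b ∈ Metric.closedBall b r := by
    rw [mem_closedBall_iff_norm, add_sub_cancel_right, norm_mul, hσ, div_mul_eq_mul_div,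
      div_le_iff₀ hM]
    gcongr
  obtain ⟨h4, h5, h6⟩ := hr' hmem
  refine ⟨h4, h5, ?_⟩
  rw [add_sub_cancel_right, smul_eq_mul, norm_mul _ z, hσ] at h6
  rw [norm_mul, hσ, show ((r / M : ℝ) : ℂ) * deriv f^[m] b * z =
    ((r / M : ℝ) : ℂ) * z * deriv f^[m] b by ring]
  refine h6.trans ?_
  calc ‖deriv f^[m] b‖ * η / M * (r / M * ‖z‖) ≤ ‖deriv f^[m] b‖ * η / M * (r / M * M) := by
        gcongr
    _ = _ := by field_simp

/-- Approximability on the union of a disc, a compact subset of a distant disc, a small disc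
near that subset and a small disc elsewhere. -/
theorem exists_radius_entireApprox {z₀ β : ℂ} {R r : ℝ} (hR : 0 < R) (hR4 : 4 * R ≤ ‖β - z₀‖)
    (hr4 : 4 * r ≤ ‖β - z₀‖) {S : Set ℂ} (hS : IsCompact S) (hSc : IsPreconnected Sᶜ)
    (hSr : S ⊆ Metric.closedBall β r) {p c : ℂ} (hpS : p ∉ S) (hpr : p ∈ Metric.ball β r)
    (hc : c ∉ Metric.closedBall z₀ R ∪ Metric.closedBall β r) :
    ∃ s > 0, Metric.closedBall p s ⊆ Metric.closedBall β r ∧ Disjoint S (Metric.closedBall p s) ∧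
      Disjoint (Metric.closedBall z₀ R ∪ Metric.closedBall β r) (Metric.closedBall c s) ∧
      ∀ G : ℂ → ℂ, EntireApprox (Metric.closedBall z₀ R) G → EntireApprox S G →
        EntireApprox (Metric.closedBall p s) G → EntireApprox (Metric.closedBall c s) G →
        EntireApprox (Metric.closedBall z₀ R ∪ (S ∪ Metric.closedBall p s) ∪
          Metric.closedBall c s) G := by
  have hne : z₀ ≠ β := by
    rintro rfl
    rw [sub_self, norm_zero] at hR4
    linarith
  have hsep := entireSeparated_closedBall_of_le hne hR4 hr4
  have hD₀ := isCompact_closedBall z₀ R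
  have hD₁ := isCompact_closedBall β r
  obtain ⟨e₁, he₁, he₁S, he₁p⟩ := exists_entire_peak hS (entireApprox_inv_sub hS hSc hpS) hpS
  obtain ⟨s₁, hs₁, hsep₁⟩ := exists_entireSeparated_closedBall he₁ he₁S he₁p
  obtain ⟨e₂, he₂, he₂D, he₂c⟩ := exists_entire_peak (hD₀.union hD₁)
    (EntireApprox.union hsep hD₀ hD₁
      (entireApprox_inv_sub hD₀ (isPreconnected_compl_closedBall _ _) fun h => hc (Or.inl h))
      (entireApprox_inv_sub hD₁ (isPreconnected_compl_closedBall _ _) fun h => hc (Or.inr h))) hc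
  obtain ⟨s₂, hs₂, hsep₂⟩ := exists_entireSeparated_closedBall he₂ he₂D he₂c
  have hsub : ∀ᶠ s in 𝓝[>] (0 : ℝ), Metric.closedBall p s ⊆ Metric.ball β r ∩ Sᶜ :=
    nhdsWithin_le_nhds (eventually_closedBall_subset
      ((Metric.isOpen_ball.inter hS.isClosed.isOpen_compl).mem_nhds ⟨hpr, hpS⟩))
  have hsub' : ∀ᶠ s in 𝓝[>] (0 : ℝ), Metric.closedBall c s ⊆
      (Metric.closedBall z₀ R ∪ Metric.closedBall β r)ᶜ :=
    nhdsWithin_le_nhds (eventually_closedBall_subset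
      ((hD₀.union hD₁).isClosed.isOpen_compl.mem_nhds hc))
  obtain ⟨s, ⟨hsp, hsc⟩, hs0, hss⟩ := ((hsub.and hsub').and
    (Ioc_mem_nhdsGT (lt_min hs₁ hs₂))).exists
  have hpβ : Metric.closedBall p s ⊆ Metric.closedBall β r := fun z hz =>
    Metric.ball_subset_closedBall (hsp hz).1
  refine ⟨s, hs0, hpβ, ?_, ?_, fun G h1 h2 h3 h4 => ?_⟩
  · exact (disjoint_compl_right.mono_right fun z hz => (hsp hz).2)
  · exact disjoint_compl_right.mono_right hsc
  · have hE := isCompact_closedBall p s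
    have h5 : EntireApprox (S ∪ Metric.closedBall p s) G :=
      EntireApprox.union (hsep₁ s (hss.trans (min_le_left _ _))) hS hE h2 h3
    have h6 : S ∪ Metric.closedBall p s ⊆ Metric.closedBall β r := Set.union_subset hSr hpβ
    have h7 := EntireApprox.union (hsep.mono subset_rfl h6) hD₀ (hS.union hE) h1 h5
    exact EntireApprox.union ((hsep₂ s (hss.trans (min_le_right _ _))).mono
      (Set.union_subset_union_right _ h6) subset_rfl) (hD₀.union (hS.union hE))
      (isCompact_closedBall c s) h7 h4

/-- A stage of the construction: an entire function `f` to be kept up to an error `ε` on the disc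
`closedBall z₀ R`, whose `n`-th iterate is close to `z ↦ α * z + β` on the set under
consideration. -/
structure Stage (z₀ : ℂ) (M : ℝ) where
  f : ℂ → ℂ
  R : ℝ
  n : ℕ
  α : ℂ
  β : ℂ
  ε : ℝ
  differentiable : Differentiable ℂ f
  fixed : f z₀ = z₀
  deriv_eq : deriv f z₀ = 2
  R_pos : 0 < R
  ε_pos : 0 < ε
  α_ne : α ≠ 0
  -- The factors 4 are those of `entireSeparated_closedBall_of_le`: the discs about `z₀` and `β`
  -- have radii at most a quarter of the distance of their centres.
  R_le : 4 * R ≤ ‖β - z₀‖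
  M_le : 4 * (‖α‖ * M) ≤ ‖β - z₀‖

/-- `F` is within the tolerance of the stage `s`. -/
def Stage.Near {z₀ : ℂ} {M : ℝ} (s : Stage z₀ M) (F : ℂ → ℂ) : Prop :=
  ∀ z ∈ Metric.closedBall z₀ s.R, ‖F z - s.f z‖ ≤ s.ε

/-- Every map near the stage is almost affine on `T` after `n` steps, staying in the disc before. -/
def Stage.Controls {z₀ : ℂ} {M : ℝ} (s : Stage z₀ M) (T : Set ℂ) (η : ℝ) : Prop :=
  ∀ F, s.Near F → (∀ z ∈ T, ∀ j < s.n, F^[j] z ∈ Metric.ball z₀ s.R) ∧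
    ∀ z ∈ T, ‖F^[s.n] z - (s.α * z + s.β)‖ ≤ ‖s.α‖ * η

theorem Stage.near_self {z₀ : ℂ} {M : ℝ} (s : Stage z₀ M) : s.Near s.f := fun z _ => by
  simpa using s.ε_pos.le

/-- The `n`-th iterate at a stage has a holomorphic left inverse near a polynomially convex
set between the images of `T'` and of `T`. -/
theorem Stage.exists_transplant {z₀ : ℂ} {M : ℝ} (s : Stage z₀ M) {S T T' : Set ℂ} {a : ℂ} {ρ : ℝ}
    (hρ : 0 < ρ) (hρ1 : ρ ≤ 1) (hS : IsCompact S) (hSc : IsPreconnected Sᶜ)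
    (hST : Metric.cthickening ρ S ⊆ T) (hT'S : Metric.cthickening ρ T' ⊆ S)
    (haT : a ∈ T) (haS : a ∉ Metric.cthickening ρ S) (hTM : T ⊆ Metric.closedBall 0 (M - 1))
    (hs : s.Controls T (ρ / 16)) :
    ∃ (S' W : Set ℂ) (χ : ℂ → ℂ), IsCompact S' ∧ IsPreconnected S'ᶜ ∧
      S' ⊆ Metric.closedBall s.β (‖s.α‖ * M) ∧ IsOpen W ∧ S' ⊆ W ∧ DifferentiableOn ℂ χ W ∧
      (∀ z ∈ T', s.f^[s.n] z ∈ interior S' ∧ χ (s.f^[s.n] z) = z) ∧ s.f^[s.n] a ∉ S' ∧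
      s.f^[s.n] a ∈ Metric.ball s.β (‖s.α‖ * M) := by
  have hα := s.α_ne
  have hαpos : 0 < ‖s.α‖ := norm_pos_iff.2 hα
  let A := affineHomeomorph s.α s.β hα
  have hA : ∀ z, A z = s.α * z + s.β := fun z => rfl
  -- Undoing the affine part leaves a map `ρ / 16`-close to the identity on `T`, which has a local
  -- inverse.
  let g : ℂ → ℂ := fun z => (s.f^[s.n] z - s.β) / s.α
  have hg : Differentiable ℂ g := ((s.differentiable.iterate s.n).sub_const _).div_const _
  have hAg : ∀ z, A (g z) = s.f^[s.n] z := fun z => by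
    rw [hA]
    simp only [g]
    field_simp
    ring
  have hgz : ∀ z ∈ T, ‖g z - z‖ ≤ ρ / 16 := by
    intro z hz
    have h1 := (hs s.f s.near_self).2 z hz
    have h2 : g z - z = (s.f^[s.n] z - (s.α * z + s.β)) / s.α := by
      simp only [g]
      field_simp
      ring
    rw [h2, norm_div, div_le_iff₀ hαpos]
    linarith
  have hSsub : S ⊆ T := (Metric.self_subset_cthickening S).trans hST
  have hT'S' : T' ⊆ S := (Metric.self_subset_cthickening T').trans hT'S
  obtain ⟨W, ψ, hW, hSW, hψ, hψg⟩ := exists_inverse_of_norm_sub_le hρ hg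
    fun z hz => hgz z (hST hz)
  have hAsymm : ∀ w, A.symm w = (w - s.β) / s.α := fun w => rfl
  have hAd : Differentiable ℂ A.symm := by
    have : (A.symm : ℂ → ℂ) = fun w => (w - s.β) / s.α := funext hAsymm
    rw [this]
    fun_prop
  refine ⟨A '' S, A.symm ⁻¹' W, ψ ∘ A.symm, hS.image A.continuous, ?_, ?_,
    hW.preimage A.symm.continuous, ?_, ?_, fun z hz => ⟨?_, ?_⟩, ?_, ?_⟩
  · rw [← A.image_compl]
    exact hSc.image _ A.continuous.continuousOn
  · rintro _ ⟨z, hz, rfl⟩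
    have h1 := hTM (hSsub hz)
    rw [mem_closedBall_zero_iff] at h1
    rw [mem_closedBall_iff_norm, hA, add_sub_cancel_right, norm_mul]
    gcongr
    linarith
  · rintro _ ⟨z, hz, rfl⟩
    rw [Set.mem_preimage, A.symm_apply_apply]
    exact hSW hz
  · exact hψ.comp hAd.differentiableOn fun w hw => hw
  · rw [← A.image_interior, ← hAg]
    refine ⟨g z, ?_, rfl⟩
    refine interior_maximal ((Metric.thickening_subset_cthickening ρ T').trans hT'S)
      Metric.isOpen_thickening (Metric.mem_thickening_iff.2 ⟨z, hz, ?_⟩)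
    rw [dist_eq_norm]
    linarith [hgz z (hSsub (hT'S' hz))]
  · rw [← hAg, Function.comp, A.symm_apply_apply]
    exact hψg z (hT'S' hz)
  · rw [← hAg]
    rintro ⟨w, hw, hwa⟩
    have h1 : w = g a := A.injective hwa
    refine haS (Metric.mem_cthickening_of_dist_le a w _ _ hw ?_)
    rw [h1, dist_eq_norm, norm_sub_rev]
    linarith [hgz a haT]
  · rw [← hAg, mem_ball_iff_norm, hA, add_sub_cancel_right, norm_mul]
    have h1 := hTM haT
    rw [mem_closedBall_zero_iff] at h1
    have h2 := hgz a haT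
    have h3 := norm_sub_norm_le (g a) a
    gcongr
    linarith

/-- The inductive step: the stage `s` can be continued to the next one, sending the current copy of
`T'` close to `z₀` and the exceptional point `a` close to `z₀ + 1`. -/
theorem Stage.exists_next {z₀ : ℂ} {M : ℝ} (hM : 0 < M) (s : Stage z₀ M) {S T T' : Set ℂ}
    {a : ℂ} {ρ : ℝ}
    (hρ : 0 < ρ) (hρ1 : ρ ≤ 1) (hS : IsCompact S) (hSc : IsPreconnected Sᶜ)
    (hT' : IsCompact T')
    (hST : Metric.cthickening ρ S ⊆ T) (hT'S : Metric.cthickening ρ T' ⊆ S)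
    (haT : a ∈ T) (haS : a ∉ Metric.cthickening ρ S) (hTM : T ⊆ Metric.closedBall 0 (M - 1))
    (hs : s.Controls T (ρ / 16)) {η : ℝ} (hη : 0 < η) :
    ∃ s' : Stage z₀ M, s.R + 1 ≤ s'.R ∧ s'.ε ≤ s.ε / 2 ∧ s.n < s'.n ∧
      (∀ z ∈ Metric.closedBall z₀ s.R, ‖s'.f z - s.f z‖ ≤ s.ε / 2) ∧ s'.Controls T' η ∧
      ∀ F, s'.Near F →
        (∀ j, s.n < j → j ≤ s'.n → ∀ z ∈ T', ∀ w ∈ T', ‖F^[j] z - F^[j] w‖ ≤ η) ∧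
        (∀ z ∈ T', ‖F^[s.n + 1] z - z₀‖ ≤ η) ∧ ‖F^[s.n + 1] a - (z₀ + 1)‖ ≤ 1 / 2 := by
  classical
  have hf := s.differentiable
  have hR := s.R_pos
  obtain ⟨S', W, χ, hS'c, hS'p, hS'r, hW, hS'W, hχ, hT'φ, haS', haβ⟩ :=
    s.exists_transplant hρ hρ1 hS hSc hST hT'S haT haS hTM hs
  have hT'T : T' ⊆ T := fun z hz => hST (Metric.self_subset_cthickening S
    (hT'S (Metric.self_subset_cthickening T' hz)))
  have hTM' : ∀ z ∈ T', ‖z‖ ≤ M := fun z hz => by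
    have := hTM (hT'T hz)
    rw [mem_closedBall_zero_iff] at this
    linarith
  have hin := (hs s.f s.near_self).1
  set f := s.f with hfdef
  set n := s.n with hndef
  set D₀ := Metric.closedBall z₀ s.R with hD₀
  set D₁ := Metric.closedBall s.β (‖s.α‖ * M) with hD₁
  have hz₀D : z₀ ∈ D₀ := Metric.mem_closedBall_self hR.le
  have hD₀₁ : Disjoint D₀ D₁ := by
    refine Metric.closedBall_disjoint_closedBall ?_
    rw [dist_comm, dist_eq_norm]
    linarith [s.R_le, s.M_le]
  -- The exit point lies outside both `D₀` and `D₁`, so the model can be prescribed near it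
  -- independently of the other pieces.
  obtain ⟨b, m, hbz, hbj, hbm, hlam⟩ := exists_exit_orbit hf s.fixed s.deriv_eq hR
    (D := D₁) Metric.isClosed_closedBall hD₀₁ (δ := η / 4) (by positivity)
  set c := f^[m] b with hcdef
  set lam := deriv f^[m] b with hlamdef
  obtain ⟨r, hr, hpr, hSp, hcr, happ⟩ := exists_radius_entireApprox hR s.R_le s.M_le hS'c hS'p
    hS'r haS' haβ hbm
  set p := f^[n] a with hpdef
  obtain ⟨σ, hσ, hscale⟩ := exists_scale hf hlam Metric.isOpen_ball hbj hM
    (τ := min (η / 4) (r / 2)) (η := η / 2) (by positivity) (by positivity)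
  set α' := σ * lam with hα'
  have hα'ne : α' ≠ 0 := mul_ne_zero hσ hlam
  have hα'pos : 0 < ‖α'‖ := norm_pos_iff.2 hα'ne
  -- All pieces lie within radius `R' - 1`; the margin `1` absorbs the later deviation of at most `1
  -- / 2` between true and model orbits.
  set R' := max (s.R + 1) (max (‖s.β - z₀‖ + ‖s.α‖ * M + 1) (‖c - z₀‖ + r + 1)) with hR'
  have hR'1 : s.R + 1 ≤ R' := le_max_left _ _
  have hR'2 : ‖s.β - z₀‖ + ‖s.α‖ * M + 1 ≤ R' := (le_max_left _ _).trans (le_max_right _ _)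
  have hR'3 : ‖c - z₀‖ + r + 1 ≤ R' := (le_max_right _ _).trans (le_max_right _ _)
  set β' : ℂ := z₀ + ((4 * R' + 4 * (‖α'‖ * M) : ℝ) : ℂ) with hβ'
  have hβ'n : ‖β' - z₀‖ = 4 * R' + 4 * (‖α'‖ * M) := by
    rw [hβ', add_sub_cancel_left, Complex.norm_real, Real.norm_eq_abs, abs_of_nonneg]
    have : 0 ≤ ‖α'‖ * M := by positivity
    linarith
  -- the model map
  let Ψ : ℂ → ℂ := fun z => if z ∈ D₀ then f z else if z ∈ S' then σ * χ z + b else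
    if z ∈ Metric.closedBall p r then z₀ + 1 else z + (β' - c)
  have hΨ₀ : Set.EqOn Ψ f D₀ := fun z hz => if_pos hz
  have hΨ₁ : Set.EqOn Ψ (fun z => σ * χ z + b) S' := fun z hz => by
    have h1 : z ∉ D₀ := fun h => Set.disjoint_left.1 hD₀₁ h (hS'r hz)
    simp only [Ψ, if_neg h1, if_pos hz]
  have hΨ₂ : Set.EqOn Ψ (fun _ => z₀ + 1) (Metric.closedBall p r) := fun z hz => by
    have h1 : z ∉ D₀ := fun h => Set.disjoint_left.1 hD₀₁ h (hpr hz)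
    have h2 : z ∉ S' := fun h => Set.disjoint_left.1 hSp h hz
    simp only [Ψ, if_neg h1, if_neg h2, if_pos hz]
  have hΨ₃ : Set.EqOn Ψ (fun z => z + (β' - c)) (Metric.closedBall c r) := fun z hz => by
    have h1 : z ∉ D₀ := fun h => Set.disjoint_left.1 hcr (Or.inl h) hz
    have h2 : z ∉ S' := fun h => Set.disjoint_left.1 hcr (Or.inr (hS'r h)) hz
    have h3 : z ∉ Metric.closedBall p r :=
      fun h => Set.disjoint_left.1 hcr (Or.inr (hpr h)) hz
    simp only [Ψ, if_neg h1, if_neg h2, if_neg h3]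
  have hne : ∀ z, z ∉ D₀ → z ≠ z₀ := fun z hz h => hz (h ▸ hz₀D)
  have hS'ne : ∀ z ∈ S', z ≠ z₀ := fun z hz =>
    hne z fun h => Set.disjoint_left.1 hD₀₁ h (hS'r hz)
  have hpne : ∀ z ∈ Metric.closedBall p r, z ≠ z₀ := fun z hz =>
    hne z fun h => Set.disjoint_left.1 hD₀₁ h (hpr hz)
  have hcne : ∀ z ∈ Metric.closedBall c r, z ≠ z₀ := fun z hz =>
    hne z fun h => Set.disjoint_left.1 hcr (Or.inl h) hz
  have hquot : ∀ {U : Set ℂ} {g : ℂ → ℂ}, DifferentiableOn ℂ g U →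
      DifferentiableOn ℂ (fun z => (g z - f z) / (z - z₀) ^ 2) (U ∩ {z₀}ᶜ) := by
    intro U g hg z hz
    have h1 : (z - z₀) ^ 2 ≠ 0 := pow_ne_zero 2 (sub_ne_zero.2 hz.2)
    have h2 : DifferentiableWithinAt ℂ g (U ∩ {z₀}ᶜ) z :=
      (hg z hz.1).mono Set.inter_subset_left
    exact (h2.sub (hf z).differentiableWithinAt).div (by fun_prop) h1
  have hcompl : IsOpen ({z₀}ᶜ : Set ℂ) := isOpen_compl_singleton
  have hEA : EntireApprox (D₀ ∪ (S' ∪ Metric.closedBall p r) ∪ Metric.closedBall c r)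
      fun z => (Ψ z - f z) / (z - z₀) ^ 2 := by
    refine happ _ ?_ ?_ ?_ ?_
    -- On `D₀` the model equals `f`, so the quotient is zero throughout, also at `z₀` by the
    -- convention on division by zero.
    · intro ε hε
      refine ⟨fun _ => 0, differentiable_const 0, fun z hz => ?_⟩
      simp [hΨ₀ hz, hε]
    · refine (entireApprox_of_differentiableOn hS'c hS'p (hW.inter hcompl)
        (fun z hz => ⟨hS'W hz, hS'ne z hz⟩)
        (hquot ((hχ.const_mul σ).add_const b))).congr fun z hz => ?_
      simp only [hΨ₁ hz]
    · refine (entireApprox_closedBall (isOpen_univ.inter hcompl)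
        (fun z hz => ⟨trivial, hpne z hz⟩)
        (hquot (g := fun _ => z₀ + 1) (differentiableOn_const _))).congr fun z hz => ?_
      simp only [hΨ₂ hz]
    · refine (entireApprox_closedBall (isOpen_univ.inter hcompl)
        (fun z hz => ⟨trivial, hcne z hz⟩)
        (hquot (g := fun z => z + (β' - c)) (by fun_prop))).congr fun z hz => ?_
      simp only [hΨ₃ hz]
  set K := D₀ ∪ (S' ∪ Metric.closedBall p r) ∪ Metric.closedBall c r with hK
  have hKc : IsCompact K := ((isCompact_closedBall _ _).union
    (hS'c.union (isCompact_closedBall _ _))).union (isCompact_closedBall _ _)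
  set V := (Metric.ball z₀ s.R ∪ (interior S' ∪ Metric.ball p r)) ∪ Metric.ball c r with hV
  have hVo : IsOpen V := (Metric.isOpen_ball.union
    (isOpen_interior.union Metric.isOpen_ball)).union Metric.isOpen_ball
  have hVK : V ⊆ K := Set.union_subset_union (Set.union_subset_union Metric.ball_subset_closedBall
    (Set.union_subset_union interior_subset Metric.ball_subset_closedBall))
    Metric.ball_subset_closedBall
  have hKR' : ∀ z ∈ K, ‖z - z₀‖ ≤ R' - 1 := by
    have hD₁R : ∀ z ∈ D₁, ‖z - z₀‖ ≤ R' - 1 := fun z hz => by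
      have h1 := mem_closedBall_iff_norm.1 hz
      have h2 := norm_sub_le_norm_sub_add_norm_sub z s.β z₀
      linarith
    rintro z ((hz | hz | hz) | hz)
    · have h1 := mem_closedBall_iff_norm.1 hz
      linarith
    · exact hD₁R z (hS'r hz)
    · exact hD₁R z (hpr hz)
    · have h1 := mem_closedBall_iff_norm.1 hz
      have h2 := norm_sub_le_norm_sub_add_norm_sub z c z₀
      linarith
  have hΨc : ContinuousOn Ψ V := by
    have h0 : ContinuousOn Ψ (Metric.ball z₀ s.R) := hf.continuous.continuousOn.congr
      (hΨ₀.mono Metric.ball_subset_closedBall)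
    have h1 : ContinuousOn Ψ (interior S') := by
      have h2 : ContinuousOn χ (interior S') :=
        hχ.continuousOn.mono (interior_subset.trans hS'W)
      exact ((continuousOn_const.mul h2).add continuousOn_const).congr
        (hΨ₁.mono interior_subset)
    have h2 : ContinuousOn Ψ (Metric.ball p r) := continuousOn_const.congr
      (hΨ₂.mono Metric.ball_subset_closedBall)
    have h3 : ContinuousOn Ψ (Metric.ball c r) :=
      (by fun_prop : Continuous fun z : ℂ => z + (β' - c)).continuousOn.congr
      (hΨ₃.mono Metric.ball_subset_closedBall)
    exact (h0.union_of_isOpen (h1.union_of_isOpen h2 isOpen_interior Metric.isOpen_ball)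
      Metric.isOpen_ball (isOpen_interior.union Metric.isOpen_ball)).union_of_isOpen h3
      (Metric.isOpen_ball.union (isOpen_interior.union Metric.isOpen_ball)) Metric.isOpen_ball
  -- orbits of the model map
  have horb₀ : ∀ z ∈ T, ∀ j ≤ n, Ψ^[j] z = f^[j] z := fun z hz =>
    iterate_eq_of_eqOn (hΨ₀.mono Metric.ball_subset_closedBall) (hin z hz)
  have horb₁ : ∀ z ∈ T', Ψ^[n + 1] z = σ * z + b := fun z hz => by
    rw [Function.iterate_succ_apply', horb₀ z (hT'T hz) n le_rfl,
      hΨ₁ (interior_subset (hT'φ z hz).1)]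
    change σ * χ _ + b = _
    rw [(hT'φ z hz).2]
  have horb₂ : ∀ z ∈ T', ∀ j ≤ m, Ψ^[n + 1 + j] z = f^[j] (σ * z + b) := fun z hz j hj => by
    rw [add_comm (n + 1), Function.iterate_add_apply, horb₁ z hz]
    exact iterate_eq_of_eqOn (hΨ₀.mono Metric.ball_subset_closedBall)
      (hscale z (hTM' z hz)).1 j hj
  have hlast : ∀ z ∈ T', f^[m] (σ * z + b) ∈ Metric.ball c r := fun z hz => by
    have h1 := ((hscale z (hTM' z hz)).2.1 m le_rfl).trans (min_le_right _ _)
    rw [mem_ball_iff_norm]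
    linarith
  have horb₃ : ∀ z ∈ T', Ψ^[n + 1 + m + 1] z = f^[m] (σ * z + b) + (β' - c) := fun z hz => by
    rw [Function.iterate_succ_apply', horb₂ z hz m le_rfl,
      hΨ₃ (Metric.ball_subset_closedBall (hlast z hz))]
  have hmaps : ∀ j < n + 1 + m + 1, ∀ z ∈ T', Ψ^[j] z ∈ V := by
    intro j hj z hz
    rcases lt_trichotomy j n with hjn | hjn | hjn
    · rw [horb₀ z (hT'T hz) j hjn.le]
      exact Or.inl (Or.inl (hin z (hT'T hz) j hjn))
    · rw [hjn, horb₀ z (hT'T hz) n le_rfl]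
      exact Or.inl (Or.inr (Or.inl (hT'φ z hz).1))
    · obtain ⟨i, rfl⟩ : ∃ i, j = n + 1 + i := ⟨j - (n + 1), by omega⟩
      rw [horb₂ z hz i (by omega)]
      rcases Nat.lt_or_ge i m with hi | hi
      · exact Or.inl (Or.inl ((hscale z (hTM' z hz)).1 i hi))
      · obtain rfl : i = m := by omega
        exact Or.inr (hlast z hz)
  have hmapsa : ∀ j < n + 1, ∀ z ∈ ({a} : Set ℂ), Ψ^[j] z ∈ V := by
    rintro j hj z rfl
    rw [horb₀ z haT j (by omega)]
    rcases Nat.lt_or_ge j n with hjn | hjn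
    · exact Or.inl (Or.inl (hin z haT j hjn))
    · rw [show j = n by omega]
      exact Or.inl (Or.inr (Or.inr (Metric.mem_ball_self hr)))
  have horba : Ψ^[n + 1] a = z₀ + 1 := by
    rw [Function.iterate_succ_apply', horb₀ a haT n le_rfl,
      hΨ₂ (Metric.mem_closedBall_self hr.le)]
  -- stability of the model map
  obtain ⟨δ₁, hδ₁, hstab₁⟩ := exists_iterate_close hVo hΨc hT' (n + 1 + m + 1) hmaps
    (ε := min (1 / 2) (min (η / 4) (‖α'‖ * (η / 2)))) (by positivity)
  obtain ⟨δ₂, hδ₂, hstab₂⟩ := exists_iterate_close hVo hΨc (isCompact_singleton (x := a)) (n + 1)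
    hmapsa (ε := 1 / 2) (by norm_num)
  have hΨz₀ : Ψ z₀ = f z₀ := hΨ₀ hz₀D
  -- Half of `min δ₁ δ₂` is spent on `f'` against the model and half on `F` against `f'`.
  set ε' := min (s.ε / 2) (min δ₁ δ₂ / 2) with hε'
  have hε'pos : 0 < ε' := by
    have := s.ε_pos
    positivity
  obtain ⟨f', hf', hf'z, hf'd, hf'K⟩ := exists_entire_correction hKc hf hΨz₀ hEA hε'pos
  let s' : Stage z₀ M :=
    { f := f', R := R', n := n + 1 + m + 1, α := α', β := β', ε := ε'
      differentiable := hf'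
      fixed := by rw [hf'z]; exact s.fixed
      deriv_eq := by rw [hf'd]; exact s.deriv_eq
      R_pos := by linarith
      ε_pos := hε'pos
      α_ne := hα'ne
      R_le := by
        have : 0 ≤ ‖α'‖ * M := by positivity
        rw [hβ'n]
        linarith
      M_le := by
        rw [hβ'n]
        linarith }
  have hclose : ∀ F, s'.Near F → ∀ z ∈ V, ‖F z - Ψ z‖ ≤ min δ₁ δ₂ := by
    intro F hF z hz
    have h1 : ‖F z - f' z‖ ≤ ε' := hF z (mem_closedBall_iff_norm.2 (by
      change ‖z - z₀‖ ≤ R'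
      linarith [hKR' z (hVK hz)]))
    have h2 := hf'K z (hVK hz)
    have h3 : ε' ≤ min δ₁ δ₂ / 2 := min_le_right _ _
    linarith [norm_sub_le_norm_sub_add_norm_sub (F z) (f' z) (Ψ z)]
  refine ⟨s', hR'1, min_le_left _ _, by change n < n + 1 + m + 1; omega, fun z hz => ?_,
    fun F hF => ⟨fun z hz j hj => ?_, fun z hz => ?_⟩,
    fun F hF => ⟨fun j hj1 hj2 z hz w hw => ?_, fun z hz => ?_, ?_⟩⟩
  · have h1 := hf'K z (Or.inl (Or.inl hz))
    rw [hΨ₀ hz] at h1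
    exact h1.le.trans (min_le_left _ _)
  · have h1 := hstab₁ F (fun w hw => (hclose F hF w hw).trans (min_le_left _ _)) j hj.le z hz
    have h2 := hKR' _ (hVK (hmaps j hj z hz))
    have h3 := h1.trans (min_le_left _ _)
    rw [mem_ball_iff_norm]
    change _ < R'
    linarith [norm_sub_le_norm_sub_add_norm_sub (F^[j] z) (Ψ^[j] z) z₀]
  · have h1 := hstab₁ F (fun w hw => (hclose F hF w hw).trans (min_le_left _ _))
      (n + 1 + m + 1) le_rfl z hz
    have h2 := h1.trans ((min_le_right _ _).trans (min_le_right _ _))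
    have h3 := (hscale z (hTM' z hz)).2.2
    change ‖F^[n + 1 + m + 1] z - (α' * z + β')‖ ≤ ‖α'‖ * η
    have h4 := norm_sub_le_norm_sub_add_norm_sub (F^[n + 1 + m + 1] z)
      (Ψ^[n + 1 + m + 1] z) (α' * z + β')
    have h5 : Ψ^[n + 1 + m + 1] z - (α' * z + β') = f^[m] (σ * z + b) - c - α' * z := by
      rw [horb₃ z hz]
      ring
    rw [h5] at h4
    linarith
  -- Four errors of `η / 4`: from `F` to the model at `z` and at `w`, and from each model orbit to
  -- the orbit of `b`.
  · have hst := hstab₁ F (fun w hw => (hclose F hF w hw).trans (min_le_left _ _)) j hj2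
    have h1 := (hst z hz).trans ((min_le_right _ _).trans (min_le_left _ _))
    have h2 := (hst w hw).trans ((min_le_right _ _).trans (min_le_left _ _))
    have h3 : ‖Ψ^[j] z - Ψ^[j] w‖ ≤ η / 4 + η / 4 := by
      have key : ∀ i ≤ m, ‖f^[i] (σ * z + b) - f^[i] (σ * w + b)‖ ≤ η / 4 + η / 4 := by
        intro i hi
        have h4 := ((hscale z (hTM' z hz)).2.1 i hi).trans (min_le_left _ _)
        have h5 := ((hscale w (hTM' w hw)).2.1 i hi).trans (min_le_left _ _)
        rw [norm_sub_rev] at h5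
        linarith [norm_sub_le_norm_sub_add_norm_sub (f^[i] (σ * z + b)) (f^[i] b)
          (f^[i] (σ * w + b))]
      change n < j at hj1
      change j ≤ n + 1 + m + 1 at hj2
      obtain ⟨i, rfl⟩ : ∃ i, j = n + 1 + i := ⟨j - (n + 1), by omega⟩
      rcases Nat.lt_or_ge m i with hi | hi
      · obtain rfl : i = m + 1 := by omega
        rw [← add_assoc, horb₃ z hz, horb₃ w hw, add_sub_add_right_eq_sub]
        exact key m le_rfl
      · rw [horb₂ z hz i hi, horb₂ w hw i hi]
        exact key i hi
    have h4 := norm_sub_le_norm_sub_add_norm_sub (F^[j] z) (Ψ^[j] z) (F^[j] w)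
    have h5 := norm_sub_le_norm_sub_add_norm_sub (Ψ^[j] z) (Ψ^[j] w) (F^[j] w)
    rw [norm_sub_rev (Ψ^[j] w)] at h5
    linarith
  · have h1 := hstab₁ F (fun w hw => (hclose F hF w hw).trans (min_le_left _ _)) (n + 1)
      (by omega) z hz
    have h2 := h1.trans ((min_le_right _ _).trans (min_le_left _ _))
    rw [horb₁ z hz] at h2
    have h3 := ((hscale z (hTM' z hz)).2.1 0 (Nat.zero_le _)).trans (min_le_left _ _)
    simp only [Function.iterate_zero, id] at h3
    have h4 := norm_sub_le_norm_sub_add_norm_sub (F^[n + 1] z) (σ * z + b) z₀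
    have h5 := norm_sub_le_norm_sub_add_norm_sub (σ * z + b) b z₀
    linarith
  · have h1 := hstab₂ F (fun w hw => (hclose F hF w hw).trans (min_le_right _ _)) (n + 1)
      le_rfl a rfl
    rwa [horba] at h1

/-! ### Passage to the limit -/

theorem exists_seq_of_step {X : Type*} {P : ℕ → X → Prop} {Q : ℕ → X → X → Prop} {x₀ : X}
    (h₀ : P 0 x₀) (h : ∀ k x, P k x → ∃ y, P (k + 1) y ∧ Q k x y) :
    ∃ u : ℕ → X, u 0 = x₀ ∧ ∀ k, P k (u k) ∧ Q k (u k) (u (k + 1)) := by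
  choose! next hP hQ using h
  let u : ℕ → X := fun k => Nat.rec x₀ next k
  have hu : ∀ k, P k (u k) := by
    intro k
    induction k with
    | zero => exact h₀
    | succ k ih => exact hP k _ ih
  exact ⟨u, rfl, fun k => ⟨hu k, hQ k _ (hu k)⟩⟩

/-- A sequence of entire functions with geometrically decreasing differences on growing discs
converges to an entire function. -/
theorem exists_entire_limit {f : ℕ → ℂ → ℂ} {z₀ d : ℂ} {R ε : ℕ → ℝ}
    (hf : ∀ k, Differentiable ℂ (f k)) (hd : ∀ k, deriv (f k) z₀ = d) (hR0 : 0 < R 0)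
    (hR : ∀ k, R k + 1 ≤ R (k + 1)) (hε0 : ∀ k, 0 < ε k) (hε : ∀ k, ε (k + 1) ≤ ε k / 2)
    (hdiff : ∀ k, ∀ z ∈ Metric.closedBall z₀ (R k), ‖f (k + 1) z - f k z‖ ≤ ε k / 2) :
    ∃ F : ℂ → ℂ, Differentiable ℂ F ∧ deriv F z₀ = d ∧
      (∀ k, ∀ z ∈ Metric.closedBall z₀ (R k), ‖F z - f k z‖ ≤ ε k) ∧
      ∀ z, Tendsto (fun k => f k z) atTop (𝓝 (F z)) := by
  have hRmono : Monotone R := monotone_nat_of_le_succ fun k => by linarith [hR k]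
  have hRk : ∀ k : ℕ, (k : ℝ) ≤ R k := by
    intro k
    induction k with
    | zero => simpa using hR0.le
    | succ k ih => push_cast; linarith [hR k]
  have hεk : ∀ k, ε k ≤ ε 0 * (1 / 2) ^ k := by
    intro k
    induction k with
    | zero => simp
    | succ k ih => rw [pow_succ]; linarith [hε k]
  have hεlim : Tendsto ε atTop (𝓝 0) := by
    refine squeeze_zero (fun k => (hε0 k).le) hεk ?_
    simpa using (tendsto_pow_atTop_nhds_zero_of_lt_one (by norm_num : (0 : ℝ) ≤ 1 / 2)
      (by norm_num)).const_mul (ε 0)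
  -- Halving gives `ε k / 2 ≤ ε k - ε (k + 1)`, so the differences telescope.
  have hle : ∀ k i, ∀ z ∈ Metric.closedBall z₀ (R k),
      ‖f (k + i) z - f k z‖ ≤ ε k - ε (k + i) := by
    intro k i z hz
    induction i with
    | zero => simp
    | succ i ih =>
      have h1 := hdiff (k + i) z (Metric.closedBall_subset_closedBall
        (hRmono (Nat.le_add_right k i)) hz)
      have h2 := norm_sub_le_norm_sub_add_norm_sub (f (k + i + 1) z) (f (k + i) z) (f k z)
      have h3 := hε (k + i)
      rw [← add_assoc]
      linarith
  have hlim : ∀ z, ∃ w, Tendsto (fun k => f k z) atTop (𝓝 w) := by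
    intro z
    refine cauchySeq_tendsto_of_complete (Metric.cauchySeq_iff'.2 fun δ hδ => ?_)
    obtain ⟨k, hk1, hk2⟩ := ((hεlim.eventually_lt_const hδ).and
      (eventually_ge_atTop ⌈‖z - z₀‖⌉₊)).exists
    refine ⟨k, fun l hl => ?_⟩
    obtain ⟨i, rfl⟩ := Nat.exists_eq_add_of_le hl
    have hz : z ∈ Metric.closedBall z₀ (R k) := mem_closedBall_iff_norm.2
      ((Nat.ceil_le.1 hk2).trans (hRk k))
    rw [dist_eq_norm]
    linarith [hle k i z hz, hε0 (k + i)]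
  choose F hF using hlim
  have hclose : ∀ k, ∀ z ∈ Metric.closedBall z₀ (R k), ‖F z - f k z‖ ≤ ε k := by
    intro k z hz
    refine le_of_tendsto ((hF z).sub_const (f k z)).norm ?_
    filter_upwards [eventually_ge_atTop k] with l hl
    obtain ⟨i, rfl⟩ := Nat.exists_eq_add_of_le hl
    linarith [hle k i z hz, hε0 (k + i)]
  have hloc : TendstoLocallyUniformlyOn f F atTop Set.univ := by
    rw [Metric.tendstoLocallyUniformlyOn_iff]
    intro δ hδ x _
    refine ⟨Metric.ball x 1, mem_nhdsWithin_of_mem_nhds (Metric.ball_mem_nhds x one_pos), ?_⟩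
    filter_upwards [hεlim.eventually_lt_const hδ,
      eventually_ge_atTop ⌈‖x - z₀‖ + 1⌉₊] with k hk1 hk2 y hy
    have h1 := (Nat.ceil_le.1 hk2).trans (hRk k)
    have h2 := norm_sub_le_norm_sub_add_norm_sub y x z₀
    rw [mem_ball_iff_norm] at hy
    rw [dist_eq_norm]
    exact (hclose k y (mem_closedBall_iff_norm.2 (by linarith))).trans_lt hk1
  have hFd : Differentiable ℂ F := differentiableOn_univ.1 (hloc.differentiableOn
    (Eventually.of_forall fun k => (hf k).differentiableOn) isOpen_univ)
  refine ⟨F, hFd, ?_, hclose, hF⟩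
  have h1 := (hloc.deriv (Eventually.of_forall fun k => (hf k).differentiableOn)
    isOpen_univ).tendsto_at (Set.mem_univ z₀)
  refine tendsto_nhds_unique h1 ?_
  simp [hd]

/-- The initial stage, with a superattracting fixed point at `z₀ + 1`. -/
noncomputable def Stage.initial (z₀ : ℂ) (M : ℝ) (h1 : 8 ≤ ‖z₀‖) (h2 : 4 * M ≤ ‖z₀‖) :
    Stage z₀ M where
  f := fun z => z₀ + 2 * (z - z₀) - (z - z₀) ^ 2
  R := 2
  n := 0
  α := 1
  β := 0
  ε := 1 / 4
  differentiable := by fun_prop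
  fixed := by simp
  deriv_eq := by
    have h1 : HasDerivAt (fun z : ℂ => z₀ + 2 * (z - z₀) - (z - z₀) ^ 2)
        (2 * 1 - (2 : ℕ) * (z₀ - z₀) ^ 1 * 1) z₀ :=
      ((((hasDerivAt_id z₀).sub_const z₀).const_mul 2).const_add z₀).sub
        (((hasDerivAt_id z₀).sub_const z₀).pow 2)
    simpa using h1.deriv
  R_pos := two_pos
  ε_pos := by norm_num
  α_ne := one_ne_zero
  R_le := by rw [zero_sub, norm_neg]; linarith
  M_le := by rw [zero_sub, norm_neg, norm_one, one_mul]; exact h2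

theorem Stage.initial_controls {z₀ : ℂ} {M : ℝ} (h1 : 8 ≤ ‖z₀‖) (h2 : 4 * M ≤ ‖z₀‖) (T : Set ℂ)
    {η : ℝ} (hη : 0 ≤ η) : (Stage.initial z₀ M h1 h2).Controls T η := by
  refine fun F _ => ⟨fun z _ j hj => absurd hj (Nat.not_lt_zero j), fun z _ => ?_⟩
  simpa [Stage.initial] using hη

/-- A map near the initial stage preserves a disc about `z₀ + 1`. -/
theorem Stage.mapsTo_of_near_initial {z₀ : ℂ} {M : ℝ} {h1 : 8 ≤ ‖z₀‖} {h2 : 4 * M ≤ ‖z₀‖}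
    {F : ℂ → ℂ} (hF : (Stage.initial z₀ M h1 h2).Near F) :
    Set.MapsTo F (Metric.closedBall (z₀ + 1) (1 / 2)) (Metric.closedBall (z₀ + 1) (1 / 2)) := by
  intro z hz
  rw [mem_closedBall_iff_norm] at hz ⊢
  have h3 : ‖F z - (z₀ + 2 * (z - z₀) - (z - z₀) ^ 2)‖ ≤ 1 / 4 := by
    refine hF z (mem_closedBall_iff_norm.2 ?_)
    change ‖z - z₀‖ ≤ 2
    have : z - z₀ = (z - (z₀ + 1)) + 1 := by ring
    rw [this]
    refine (norm_add_le _ _).trans ?_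
    rw [norm_one]
    linarith
  -- In the coordinate `v = z - (z₀ + 1)` the initial map is `v ↦ -v ^ 2`; on the disc of radius `1
  -- / 2` this gives `1 / 4`, plus the tolerance `1 / 4`.
  have h4 : F z - (z₀ + 1) = (F z - (z₀ + 2 * (z - z₀) - (z - z₀) ^ 2)) -
      (z - (z₀ + 1)) ^ 2 := by ring
  rw [h4]
  refine (norm_sub_le _ _).trans ?_
  rw [norm_pow]
  nlinarith [norm_nonneg (z - (z₀ + 1))]

/-- The image lies within `‖α‖ * M` of `β`, at most a quarter of `‖β - z₀‖`, while `‖β - z₀‖` is at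
least `4 * R`. -/
theorem Stage.le_norm_iterate {z₀ : ℂ} {M : ℝ} (s : Stage z₀ M) {T : Set ℂ} {η : ℝ} (hη : η ≤ 1)
    (hT : T ⊆ Metric.closedBall 0 (M - 1)) (hs : s.Controls T η) {F : ℂ → ℂ} (hF : s.Near F)
    {z : ℂ} (hz : z ∈ T) : s.R ≤ ‖F^[s.n] z - z₀‖ := by
  have h1 := (hs F hF).2 z hz
  have h2 := mem_closedBall_zero_iff.1 (hT hz)
  have h3 : ‖s.α * z‖ ≤ ‖s.α‖ * (M - 1) := by
    rw [norm_mul]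
    gcongr
  have h4 : ‖s.α‖ * η ≤ ‖s.α‖ := mul_le_of_le_one_right (norm_nonneg _) hη
  have h5 : ‖s.β - z₀‖ ≤ ‖F^[s.n] z - z₀‖ + ‖F^[s.n] z - (s.α * z + s.β)‖ + ‖s.α * z‖ := by
    have : s.β - z₀ = (F^[s.n] z - z₀) - (F^[s.n] z - (s.α * z + s.β)) - s.α * z := by ring
    rw [this]
    exact (norm_sub_le _ _).trans (by gcongr; exact norm_sub_le _ _)
  linarith [s.R_le, s.M_le, s.R_pos]

/-- After normalising by `α` and `β`, the iterate is close to the identity on a thickening of `S`.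
This is the source of univalence. -/
theorem Stage.injOn_iterate {z₀ : ℂ} {M : ℝ} (s : Stage z₀ M) {S T : Set ℂ} {ρ : ℝ} (hρ : 0 < ρ)
    (hST : Metric.cthickening ρ S ⊆ T) (hs : s.Controls T (ρ / 16)) {F : ℂ → ℂ}
    (hFd : Differentiable ℂ F) (hF : s.Near F) : Set.InjOn F^[s.n] S := by
  have hα := s.α_ne
  have hαpos : 0 < ‖s.α‖ := norm_pos_iff.2 hα
  have hinj := injOn_of_norm_sub_le (X := S) hρ (g := fun z => (F^[s.n] z - s.β) / s.α)
    (((hFd.iterate s.n).sub_const _).div_const _) (fun z hz => by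
      have h1 := (hs F hF).2 z (hST hz)
      have h2 : (F^[s.n] z - s.β) / s.α - z = (F^[s.n] z - (s.α * z + s.β)) / s.α := by
        field_simp
        ring
      rw [h2, norm_div, div_le_iff₀ hαpos]
      linarith)
  intro z hz w hw hzw
  exact hinj hz hw (by simp only [hzw])

/-! ### Dynamics of the limit function and the main theorem -/

/-- A function whose iterates shrink `Ω`, send it alternately far away and close to a repelling
fixed point, and have bounded orbits accumulating at every boundary point of `Ω`, has `Ω` as an
oscillating wandering domain. -/
theorem isOscillatingWanderingDomain_of_orbits {F : ℂ → ℂ} (hF : Differentiable ℂ F) {Ω : Set ℂ}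
    (hopen : IsOpen Ω) (hconn : IsConnected Ω) {c : ℂ} (hc : F c = c) (hdc : deriv F c = 2)
    {n : ℕ → ℕ} (hn : StrictMono n) {η R : ℕ → ℝ} (hη : Tendsto η atTop (𝓝 0))
    (hR : Tendsto R atTop atTop)
    (hdiam : ∀ k j, n k < j → j ≤ n (k + 1) → ∀ z ∈ Ω, ∀ w ∈ Ω, ‖F^[j] z - F^[j] w‖ ≤ η k)
    (hfar : ∀ k, ∀ z ∈ Ω, R k ≤ ‖F^[n k] z - c‖)
    (hnear : ∀ k, ∀ z ∈ Ω, ‖F^[n k + 1] z - c‖ ≤ η k)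
    (hbdd : ∀ p ∈ frontier Ω, ∀ U, IsOpen U → p ∈ U →
      ∃ a ∈ U, ∃ C : ℝ, ∀ᶠ j in atTop, ‖F^[j] a‖ ≤ C) :
    IsOscillatingWanderingDomain F Ω := by
  have hdiam' : ∀ ε > 0, ∀ᶠ j in atTop, ∀ z ∈ Ω, ∀ w ∈ Ω, dist (F^[j] z) (F^[j] w) ≤ ε := by
    intro ε hε
    obtain ⟨N, hN⟩ := eventually_atTop.1 (hη.eventually_lt_const hε)
    filter_upwards [eventually_gt_atTop (n N)] with j hj z hz w hw
    -- The least such `k` places `j` in the block `n (k - 1) < j ≤ n k`, where `hdiam` applies.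
    have hex : ∃ k, j ≤ n k := ⟨j, hn.id_le j⟩
    classical
    have hspec := Nat.find_spec hex
    have hmin := fun i hi => Nat.find_min hex (m := i) hi
    set k := Nat.find hex
    have hNk : N < k := hn.lt_iff_lt.1 (hj.trans_le hspec)
    obtain ⟨i, hi⟩ := Nat.exists_eq_succ_of_ne_zero (by omega : k ≠ 0)
    rw [dist_eq_norm]
    rw [hi] at hspec
    exact (hdiam i j (not_le.1 (hmin i (by omega))) hspec z hz w hw).trans
      (hN i (by omega)).le
  have hinf : ∀ K ⊆ Ω, ∀ C : ℝ, ∀ᶠ k in atTop, ∀ z ∈ K, C < ‖F^[n k] z‖ := by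
    intro K hK C
    filter_upwards [hR.eventually_gt_atTop (C + ‖c‖)] with k hk z hz
    have h1 := hfar k z (hK hz)
    have h2 := norm_sub_le (F^[n k] z) c
    linarith
  have hsub : Ω ⊆ fatouSet F := fun p hp => ⟨Ω, hopen, hp, isNormalFamilyOn_of_diam hdiam'⟩
  have hfr : ∀ p ∈ frontier Ω, p ∉ fatouSet F := by
    intro p hp
    refine notMem_fatouSet (φ := n) fun U hU hpU => ⟨?_, ?_⟩
    · obtain ⟨x, hxU, hx⟩ := mem_closure_iff.1 (frontier_subset_closure hp) U hU hpU
      refine ⟨x, hxU, tendsto_atTop.2 fun C => ?_⟩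
      filter_upwards [hinf {x} (by simpa using hx) C] with k hk
      exact (hk x rfl).le
    · obtain ⟨a, haU, C, ha⟩ := hbdd p hp U hU hpU
      exact ⟨a, haU, C, hn.tendsto_atTop.eventually ha⟩
  refine ⟨⟨isFatouComponent_of_frontier hopen hconn hsub hfr,
    not_isPreperiodicSet hF hc hdc hdiam' ?_ ?_⟩, ⟨n, hn, fun K hK _ C => hinf K hK C⟩, c,
    fun k => n k + 1, fun i j hij => Nat.add_lt_add_right (hn hij) 1, ?_⟩
  · intro x hx ε hε
    have h1 : Tendsto (fun k => n k + 1) atTop atTop :=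
      (tendsto_add_atTop_nat 1).comp hn.tendsto_atTop
    refine h1.frequently (Eventually.frequently ?_)
    filter_upwards [hη.eventually_lt_const hε] with k hk
    rw [dist_eq_norm]
    exact (hnear k x hx).trans_lt hk
  · intro x hx C
    refine hn.tendsto_atTop.frequently (Eventually.frequently ?_)
    filter_upwards [hR.eventually_gt_atTop C] with k hk
    rw [dist_eq_norm]
    exact hk.trans_le (hfar k x hx)
  · apply TendstoUniformlyOn.tendstoLocallyUniformlyOn
    rw [Metric.tendstoUniformlyOn_iff]
    intro ε hε
    filter_upwards [hη.eventually_lt_const hε] with k hk z hz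
    rw [dist_comm, dist_eq_norm]
    exact (hnear k z hz).trans_lt hk

theorem theorem2 (Ω : Set ℂ) (hbdd : Bornology.IsBounded Ω) (hopen : IsOpen Ω)
    (hconn : IsConnected Ω) (hreg : interior (closure Ω) = Ω)
    (hcompl : IsConnected (closure Ω)ᶜ) :
    ∃ f : ℂ → ℂ, Differentiable ℂ f ∧ IsOscillatingWanderingDomain f Ω ∧
      ∀ n : ℕ, Set.InjOn f^[n] Ω := by
  have hK : IsCompact (closure Ω) := hbdd.isCompact_closure
  have hfr : (frontier Ω).Nonempty := by
    refine nonempty_frontier_iff.2 ⟨hconn.nonempty, fun h => ?_⟩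
    rw [h, closure_univ, Set.compl_univ] at hcompl
    exact Set.not_nonempty_empty hcompl.nonempty
  have : Nonempty (frontier Ω) := hfr.to_subtype
  let q : ℕ → frontier Ω := TopologicalSpace.denseSeq (frontier Ω)
  -- Unpairing makes every point of the dense sequence occur infinitely often, so the `a k`
  -- accumulate at each of them.
  let x : ℕ → ℂ := fun k => q k.unpair.1
  obtain ⟨N⟩ := exists_nestedNhds hK hcompl (x := x)
    (fun k => frontier_subset_closure (q k.unpair.1).2) (fun k => by
      -- Regularity enters here: frontier points of `Ω` are limits of points outside `closure Ω`.
      rw [closure_compl, hreg]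
      have := (q k.unpair.1).2.2
      rwa [hopen.interior_eq] at this)
  have hTanti : ∀ k, N.T k ⊆ N.T 0 := by
    intro k
    induction k with
    | zero => exact subset_rfl
    | succ k ih =>
      refine Set.Subset.trans ?_ ih
      exact ((Metric.self_subset_cthickening _).trans (N.T_subset k)).trans
        ((Metric.self_subset_cthickening _).trans (N.S_subset k))
  obtain ⟨r, hr0, hr⟩ := (N.isCompact_T 0).isBounded.exists_pos_norm_le
  set M := r + 1 with hM
  have hTM : ∀ k, N.T k ⊆ Metric.closedBall 0 (M - 1) := fun k z hz => by
    rw [mem_closedBall_zero_iff, hM, add_sub_cancel_right]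
    exact hr z (hTanti k hz)
  -- This makes `‖z₀‖` at least `4 * 2` and `4 * M`, the two inequalities of the initial stage with
  -- `R = 2`, `α = 1`, `β = 0`.
  set z₀ : ℂ := ((4 * M + 8 : ℝ) : ℂ) with hz₀
  have hz₀n : ‖z₀‖ = 4 * M + 8 := by
    rw [hz₀, Complex.norm_real, Real.norm_eq_abs, abs_of_pos (by positivity)]
  have h1 : 8 ≤ ‖z₀‖ := by rw [hz₀n]; linarith
  have h2 : 4 * M ≤ ‖z₀‖ := by rw [hz₀n]; linarith
  -- The first bound gives the control required at the next stage, the second makes the images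
  -- shrink to zero.
  let η : ℕ → ℝ := fun k => min (N.ρ (k + 1) / 16) (1 / ((k : ℝ) + 1))
  have hηpos : ∀ k, 0 < η k := fun k => by
    have := N.ρ_pos (k + 1)
    positivity
  obtain ⟨s, hs0, hs⟩ := exists_seq_of_step (x₀ := Stage.initial z₀ M h1 h2)
    (P := fun k s => s.Controls (N.T k) (N.ρ k / 16))
    (Q := fun k s s' => s.R + 1 ≤ s'.R ∧ s'.ε ≤ s.ε / 2 ∧ s.n < s'.n ∧
      (∀ z ∈ Metric.closedBall z₀ s.R, ‖s'.f z - s.f z‖ ≤ s.ε / 2) ∧ ∀ F, s'.Near F →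
        (∀ j, s.n < j → j ≤ s'.n → ∀ z ∈ N.T (k + 1), ∀ w ∈ N.T (k + 1),
          ‖F^[j] z - F^[j] w‖ ≤ η k) ∧
        (∀ z ∈ N.T (k + 1), ‖F^[s.n + 1] z - z₀‖ ≤ η k) ∧
        ‖F^[s.n + 1] (N.a k) - (z₀ + 1)‖ ≤ 1 / 2)
    (Stage.initial_controls h1 h2 _ (by have := N.ρ_pos 0; positivity))
    (fun k s hs => by
      obtain ⟨s', h3, h4, h5, h6, h7, h8⟩ := s.exists_next (by positivity) (N.ρ_pos k) (N.ρ_le k)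
        (N.isCompact_S k) (N.compl_S k) (N.isCompact_T (k + 1)) (N.S_subset k) (N.T_subset k)
        (N.a_mem k) (N.a_notMem k) (hTM k) hs (hηpos k)
      refine ⟨s', fun F hF => ⟨(h7 F hF).1, fun z hz => ((h7 F hF).2 z hz).trans ?_⟩,
        h3, h4, h5, h6, h8⟩
      gcongr
      exact min_le_left _ _)
  obtain ⟨F, hF, hFd, hFclose, hFlim⟩ := exists_entire_limit (f := fun k => (s k).f)
    (R := fun k => (s k).R) (ε := fun k => (s k).ε) (fun k => (s k).differentiable)
    (fun k => (s k).deriv_eq) (s 0).R_pos (fun k => (hs k).2.1) (fun k => (s k).ε_pos)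
    (fun k => (hs k).2.2.1) (fun k => (hs k).2.2.2.2.1)
  have hnear : ∀ k, (s k).Near F := hFclose
  have hfix : F z₀ = z₀ :=
    tendsto_nhds_unique (hFlim z₀) (by simp only [(s _).fixed]; exact tendsto_const_nhds)
  have hnmono : StrictMono fun k => (s k).n := strictMono_nat_of_lt_succ fun k => (hs k).2.2.2.1
  have hΩT : ∀ k, Ω ⊆ N.T k := fun k => subset_closure.trans (N.subset_T k)
  have hηlim : Tendsto η atTop (𝓝 0) := squeeze_zero (fun k => (hηpos k).le)
    (fun k => min_le_right _ _) tendsto_one_div_add_atTop_nhds_zero_nat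
  have hRlim : Tendsto (fun k => (s k).R) atTop atTop := by
    have hRk : ∀ k : ℕ, (k : ℝ) ≤ (s k).R := by
      intro k
      induction k with
      | zero => simpa using (s 0).R_pos.le
      | succ k ih => push_cast; linarith [(hs k).2.1]
    exact tendsto_atTop_mono hRk tendsto_natCast_atTop_atTop
  have hstep : ∀ k, _ := fun k => (hs k).2.2.2.2.2 F (hnear (k + 1))
  refine ⟨F, hF, isOscillatingWanderingDomain_of_orbits hF hopen hconn hfix hFd hnmono hηlim hRlim
    (fun k j hj1 hj2 z hz w hw => (hstep k).1 j hj1 hj2 z (hΩT _ hz) w (hΩT _ hw))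
    (fun k z hz => (s k).le_norm_iterate (by linarith [N.ρ_le k]) (hTM k) (hs k).1 (hnear k)
      (hΩT k hz))
    (fun k z hz => (hstep k).2.1 z (hΩT _ hz)) ?_, fun n => ?_⟩
  · intro p hp U hU hpU
    obtain ⟨δ, hδ, hδU⟩ := Metric.isOpen_iff.1 hU p hpU
    obtain ⟨i, hi⟩ := (TopologicalSpace.denseRange_denseSeq (frontier Ω)).exists_dist_lt
      (⟨p, hp⟩ : frontier Ω) (half_pos hδ)
    obtain ⟨j, hj⟩ := exists_nat_one_div_lt (half_pos hδ)
    set k := Nat.pair i j with hk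
    have hxk : x k = q i := by simp only [x, hk, Nat.unpair_pair]
    have hak : dist (N.a k) p < δ := by
      have h3 := N.dist_a k
      have h4 : 1 / ((k : ℝ) + 1) ≤ 1 / ((j : ℝ) + 1) :=
        Nat.one_div_le_one_div (Nat.right_le_pair i j)
      have h5 : dist (q i : ℂ) p < δ / 2 := by
        rw [dist_comm]
        exact hi
      rw [hxk] at h3
      linarith [dist_triangle (N.a k) (q i) p]
    refine ⟨N.a k, hδU hak, ‖z₀ + 1‖ + 1 / 2, ?_⟩
    -- After time `(s k).n + 1` the orbit of `a k` is trapped in the invariant disc about `z₀ + 1`.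
    have hmaps := Stage.mapsTo_of_near_initial (hs0 ▸ hnear 0)
    have ha : F^[(s k).n + 1] (N.a k) ∈ Metric.closedBall (z₀ + 1) (1 / 2) :=
      mem_closedBall_iff_norm.2 (hstep k).2.2
    filter_upwards [eventually_ge_atTop ((s k).n + 1)] with l hl
    obtain ⟨i', rfl⟩ := Nat.exists_eq_add_of_le hl
    have h3 := hmaps.iterate i' ha
    rw [← Function.iterate_add_apply, add_comm i', mem_closedBall_iff_norm] at h3
    linarith [norm_sub_norm_le (F^[(s k).n + 1 + i'] (N.a k)) (z₀ + 1)]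
  -- As `n ≤ (s n).n`, the iterate of order `(s n).n` factors through `F^[n]`, which inherits
  -- injectivity.
  · have h3 := ((s n).injOn_iterate (N.ρ_pos n) (N.S_subset n) (hs n).1 hF (hnear n)).mono
      (subset_closure.trans (N.subset_S n))
    have h4 : n ≤ (s n).n := hnmono.id_le n
    intro z hz w hw hzw
    refine h3 hz hw ?_
    rw [← Nat.sub_add_cancel h4, Function.iterate_add_apply, hzw, ← Function.iterate_add_apply]
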